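/- Let $V$ be a right quaternionic Hilbert space, equipped with a Hilbert basis $(e_k)$ and with the left scalar multiplication $qf=\sum_k e_k\,q\,\langle e_k,f\rangle$ that it induces; let $\mathcal B(V)$ be the set of bounded right linear operators on $V$. For a bounded right linear operator $T$ put $Q_q(T)=T^2-2\,\mathrm{Re}(q)\,T+|q|^2\mathbb I$ for $q\in\mathbb H$, let $\rho_S(T)$ be the set of $q\in\mathbb H$ for which $Q_q(T)$ has a bounded inverse, let $\sigma_S(T)=\mathbb H\setminus\rho_S(T)$, and for $q\in\rho_S(T)$ put $S_L^{-1}(q,T)=-Q_q(T)^{-1}(T-\overline q\,\mathbb I)$. Let $\mathbb S$ be the sphere of imaginary units of $\mathbb H$ and $\mathbb C_I=\mathbb R+I\mathbb R$ for $I\in\mathbb S$. A set $U\subset\mathbb H$ is axially symmetric if it contains $[q]=\{\mathrm{Re}(q)+I|\mathrm{Im}(q)| : I\in\mathbb S\}$ for each $q\in U$. An axially symmetric set $\sigma\subset\sigma_S(T)$ is an isolated part of $\sigma_S(T)$ if $\sigma$ and $\sigma_S(T)\setminus\sigma$ are closed. The Riesz projection of $T\in\mathcal B(V)$ for such a $\sigma$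 is $$P_\sigma=\frac1{2\pi}\int_{\partial(U\cap\mathbb C_I)}S_L^{-1}(q,T)\,dq_I,\qquad dq_I=-dq\,I,$$ where $I\in\mathbb S$ and $U\subset\mathbb H$ is a bounded, axially symmetric open set with $U\cap\sigma_S(T)=\sigma$ such that, for every $I\in\mathbb S$, the boundary $\partial(U\cap\mathbb C_I)$ lies in $\rho_S(T)$ and is a union of finitely many continuously differentiable Jordan curves, oriented positively with respect to $U\cap\mathbb C_I$. Theorem. Let $T\in\mathcal B(V)$ and let $P\in\mathcal B(V)$ be a projection ($P^2=P$) with $TP=PT$. Put $T_1=TP|_{R(P)}$, an operator on the range $R(P)$, and $T_2=T(\mathbb I-P)|_{N(P)}$, an operator on the null space $N(P)$. If $\mathrm{dist}(\sigma_S(T_1),\sigma_S(T_2))>0$ (with $\mathrm{dist}=+\infty$ if one of the sets is empty), then $\sigma_S(T_1)$ is an axially symmetric isolated part of $\sigma_S(T)$, its Riesz projection $P_{\sigma_S(T_1)}$ exists and does not depend on the choice of $U$, of $I$ and of the parametrization of the boundary, and $$R(P)=R(P_{\sigma_S(T_1)}),\qquad N(P)=N(P_{\sigma_S(T_1)}).$$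 -/

import Mathlib

open scoped Quaternion
open MulOpposite Set

noncomputable section

namespace QuaternionicRiesz

/-! ### Quaternions -/

/-- The sphere `𝕊` of imaginary units of `ℍ`. -/
def imagUnits : Set ℍ := {I | I.re = 0 ∧ ‖I‖ = 1}

/-- The sphere `[q] = {Re q + I |Im q| : I ∈ 𝕊}`. -/
def sphere (q : ℍ) : Set ℍ := {p | ∃ I ∈ imagUnits, p = (q.re : ℍ) + I * (‖q.im‖ : ℍ)}

/-- `U` is axially symmetric if it contains `[q]` for each of its points `q`. -/
def IsAxiallySymmetric (U : Set ℍ) : Prop := ∀ q ∈ U, sphere q ⊆ U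

/-- The identification `x + i y ↦ x + I y` of `ℂ` with the slice `ℂ_I = ℝ + I ℝ`. -/
def sliceEmb (I : ℍ) (z : ℂ) : ℍ := (z.re : ℍ) + I * (z.im : ℍ)

/-- `U ∩ ℂ_I`, seen in `ℂ` through the identification of `ℂ` with `ℂ_I`. -/
def slice (I : ℍ) (U : Set ℍ) : Set ℂ := sliceEmb I ⁻¹' U

/-! ### Right quaternionic Hilbert spaces

A right `ℍ`-vector space is a module over `ℍᵐᵒᵖ`; the vector `f q` is `op q • f`. -/

/-- An `ℍ`-valued inner product on a right `ℍ`-vector space, which induces its norm. -/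
class RightInner (V : Type*) [NormedAddCommGroup V] [Module ℍᵐᵒᵖ V] where
  /-- the inner product `⟨f, g⟩` -/
  qinner : V → V → ℍ
  qinner_smul_add : ∀ (f g h : V) (q : ℍ), qinner f (op q • g + h) = qinner f g * q + qinner f h
  star_qinner : ∀ f g : V, star (qinner g f) = qinner f g
  qinner_self : ∀ f : V, qinner f f = ((‖f‖ ^ 2 : ℝ) : ℍ)

open RightInner (qinner)

section Hilbert

variable {V : Type*} [NormedAddCommGroup V] [Module ℍᵐᵒᵖ V] [RightInner V]

/-- `e` is a Hilbert basis: an orthonormal family whose right linear span is dense. -/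
structure IsHilbertBasis {ι : Type*} (e : ι → V) : Prop where
  norm_eq_one : ∀ k, qinner (e k) (e k) = 1
  orthogonal : ∀ k l, k ≠ l → qinner (e k) (e l) = 0
  dense_span : Dense (Submodule.span ℍᵐᵒᵖ (range e) : Set V)

/-- The left scalar multiplication `q f = ∑ₖ eₖ q ⟨eₖ, f⟩` induced by a Hilbert basis `e`. -/
def leftMul {ι : Type*} (e : ι → V) (q : ℍ) (f : V) : V := ∑' k, op (q * qinner (e k) f) • e k

end Hilbert

/-! ### The `S`-spectrum -/

section Spectrum

variable {W : Type*} [NormedAddCommGroup W] [NormedSpace ℝ W] [Module ℍᵐᵒᵖ W]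
  [IsScalarTower ℝ ℍᵐᵒᵖ W]

/-- `Q_q(T) = T² - 2 Re(q) T + |q|² 𝕀`. -/
def qOp (T : W →L[ℍᵐᵒᵖ] W) (q : ℍ) : W →L[ℍᵐᵒᵖ] W := T ^ 2 - (2 * q.re) • T + (‖q‖ ^ 2) • 1

/-- The `S`-resolvent set: the `q` for which `Q_q(T)` has a bounded inverse. -/
def sResolventSet (T : W →L[ℍᵐᵒᵖ] W) : Set ℍ := {q | IsUnit (qOp T q)}

/-- The `S`-spectrum. -/
def sSpectrum (T : W →L[ℍᵐᵒᵖ] W) : Set ℍ := (sResolventSet T)ᶜ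

/-- `σ` is an axially symmetric isolated part of `σ_S(T)`. -/
structure IsIsolatedPart (T : W →L[ℍᵐᵒᵖ] W) (σ : Set ℍ) : Prop where
  subset : σ ⊆ sSpectrum T
  axiallySymmetric : IsAxiallySymmetric σ
  isClosed : IsClosed σ
  isClosed_diff : IsClosed (sSpectrum T \ σ)

end Spectrum

/-! ### Contours -/

/-- A continuously differentiable Jordan curve in the plane, parametrized by `[0, 1]`. -/
structure IsC1JordanCurve (γ : ℝ → ℂ) : Prop where
  contDiffOn : ContDiffOn ℝ 1 γ (Icc 0 1)
  closed : γ 0 = γ 1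
  injOn : InjOn γ (Ico 0 1)

/-- The winding number of a finite family of closed curves around `w`. -/
def windingNumber {n : ℕ} (γ : Fin n → ℝ → ℂ) (w : ℂ) : ℂ :=
  (2 * Real.pi * Complex.I)⁻¹ * ∑ k, ∫ t in (0 : ℝ)..1, deriv (γ k) t / (γ k t - w)

/-- The boundary of `D` is the union of the finitely many `C¹` Jordan curves `γ k`, which are
oriented so that together they wind once around each point of `D` and do not wind around the
points outside the closure of `D`. -/
structure IsPositiveBoundary (D : Set ℂ) {n : ℕ} (γ : Fin n → ℝ → ℂ) : Prop where
  isC1JordanCurve : ∀ k, IsC1JordanCurve (γ k)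
  iUnion_image : ⋃ k, γ k '' Icc 0 1 = frontier D
  winding_inside : ∀ w ∈ D, windingNumber γ w = 1
  winding_outside : ∀ w ∉ closure D, windingNumber γ w = 0

/-! ### The Riesz projection -/

section Riesz

variable {V : Type*} [NormedAddCommGroup V] [NormedSpace ℝ V] [Module ℍᵐᵒᵖ V]
  [IsScalarTower ℝ ℍᵐᵒᵖ V]

/-- `U` is an open set which may be used to define the Riesz projection for `σ`: it is bounded,
open, axially symmetric, contains `σ` and no other point of `σ_S(T)`, and for each `I ∈ 𝕊` the
boundary of `U ∩ ℂ_I` lies in `ρ_S(T)` and consists of finitely many `C¹` Jordan curves. -/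
structure IsRieszDomain (T : V →L[ℍᵐᵒᵖ] V) (σ U : Set ℍ) : Prop where
  isOpen : IsOpen U
  isBounded : Bornology.IsBounded U
  axiallySymmetric : IsAxiallySymmetric U
  inter_eq : U ∩ sSpectrum T = σ
  frontier_subset : ∀ I ∈ imagUnits, sliceEmb I '' frontier (slice I U) ⊆ sResolventSet T
  exists_curves : ∀ I ∈ imagUnits, ∃ (n : ℕ) (γ : Fin n → ℝ → ℂ), IsPositiveBoundary (slice I U) γ

variable [RightInner V] {ι : Type*}

/-- The left `S`-resolvent operator `S_L⁻¹(q, T) = - Q_q(T)⁻¹ (T - q̄ 𝕀)`, where `q̄ 𝕀` is the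
left multiplication by `q̄` with respect to the Hilbert basis `e`. -/
def sLeftResolvent (e : ι → V) (T : V →L[ℍᵐᵒᵖ] V) (q : ℍ) (f : V) : V :=
  -(Ring.inverse (qOp T q)) (T f - leftMul e (star q) f)

/-- `(1 / 2π) ∫_γ S_L⁻¹(q, T) dq_I`, applied to `f`, where `dq_I = - dq I`, the curves `γ` lie
in `ℂ_I`, and an operator is multiplied by a scalar on the right by `(A q) f = A (q f)`. -/
def rieszIntegral (e : ι → V) (T : V →L[ℍᵐᵒᵖ] V) (I : ℍ) {n : ℕ} (γ : Fin n → ℝ → ℂ) (f : V) :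
    V :=
  (2 * Real.pi)⁻¹ • ∑ k, ∫ t in (0 : ℝ)..1,
    sLeftResolvent e T (sliceEmb I (γ k t)) (leftMul e (-(sliceEmb I (deriv (γ k) t) * I)) f)

/-- `E` is the Riesz projection `P_σ` of `T`, computed with some admissible open set `U`, some
slice `ℂ_I` and some positively oriented parametrization of the boundary of `U ∩ ℂ_I`. -/
def IsRieszProjection (e : ι → V) (T : V →L[ℍᵐᵒᵖ] V) (σ : Set ℍ) (E : V →L[ℍᵐᵒᵖ] V) : Prop :=
  IsIsolatedPart T σ ∧
    ∃ U : Set ℍ, IsRieszDomain T σ U ∧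
      ∃ I ∈ imagUnits, ∃ (n : ℕ) (γ : Fin n → ℝ → ℂ), IsPositiveBoundary (slice I U) γ ∧
        ∀ f : V, E f = rieszIntegral e T I γ f

end Riesz

/-! ### The parts of an operator in the range and the kernel of a commuting operator -/

section Parts

variable {V : Type*} [NormedAddCommGroup V] [Module ℍᵐᵒᵖ V]

theorem mul_mem_range {T P : V →L[ℍᵐᵒᵖ] V} (h : T * P = P * T) (x : V) :
    (T * P) x ∈ LinearMap.range (P : V →ₗ[ℍᵐᵒᵖ] V) := by
  rw [h]
  exact ⟨T x, rfl⟩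

theorem mul_mem_ker {T P : V →L[ℍᵐᵒᵖ] V} (h : T * P = P * T) (x : V)
    (hx : x ∈ LinearMap.ker (P : V →ₗ[ℍᵐᵒᵖ] V)) :
    (T * (1 - P)) x ∈ LinearMap.ker (P : V →ₗ[ℍᵐᵒᵖ] V) := by
  have hx' : P x = 0 := hx
  have h' : P (T x) = T (P x) := (DFunLike.congr_fun h x).symm
  simp [hx', h']

/-- `T P` restricted to `R(P)`, as an operator on `R(P)`. -/
def rangePart (T P : V →L[ℍᵐᵒᵖ] V) (h : T * P = P * T) :
    LinearMap.range (P : V →ₗ[ℍᵐᵒᵖ] V) →L[ℍᵐᵒᵖ] LinearMap.range (P : V →ₗ[ℍᵐᵒᵖ] V) :=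
  (T * P).restrict fun x _ => mul_mem_range h x

/-- `T (𝕀 - P)` restricted to `N(P)`, as an operator on `N(P)`. -/
def kerPart (T P : V →L[ℍᵐᵒᵖ] V) (h : T * P = P * T) :
    LinearMap.ker (P : V →ₗ[ℍᵐᵒᵖ] V) →L[ℍᵐᵒᵖ] LinearMap.ker (P : V →ₗ[ℍᵐᵒᵖ] V) :=
  (T * (1 - P)).restrict fun x hx => mul_mem_ker h x hx

end Parts

end QuaternionicRiesz

end

/-! The proof replaces the quaternionic calculus by the complex one. Right multiplication by `ℂ ⊂ ℍ`
turns `V` into a complex Banach space `Cx V` on which `T` is complex linear, and `Q_q(T) = (z -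
T)(z̄ - T)` whenever `z` has the real part and the modulus of `q` (`toCx_qOp_eq_mul`). So contours
in a slice of `ρ_S(T)` lie in the ordinary resolvent set.

If a contour winds `c` times around every spectral point, the integral of the resolvent over it is
`2πi c`; this follows from the resolvent identity and Liouville's theorem
(`sum_integral_resolvent`). Since `T` is the direct sum of `T₁` and `T₂`, and an admissible contour
winds once around the spectrum of `T₁` and not at all around that of `T₂`, the resolvent of `T`
integrates to `2πi P` (`sum_integral_resolvent_eq`). The integrand of the Riesz integral is a
combination of complex resolvents applied to `f`, `f j`, `I f`, `(I f) j`, multiplied on the right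
by `i` and `j` (`sLeftResolvent_eq`). As `P` is right linear, the integral equals `P` for every
admissible `U`, `I` and contour (`rieszIntegral_eq`), which yields independence of the choices and
the equality of ranges and kernels together.

What remains is the existence of an admissible `U` (`exists_isRieszDomain`). A slice of `σ_S(T₁)` is
covered by the squares of a fine grid that meet it. The boundary edges of their union form a
balanced directed graph, which splits into simple cycles; these become `C¹` Jordan curves by slowing
down to velocity zero at the corners. Winding numbers are computed square by square with logarithms
(`exists_symmetric_neighbourhood`), and rotation about the real axis produces `U`. -/

noncomputable section

namespace QuaternionicRiesz

/-! ### Balanced sets of directed edges -/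

section Digraph

variable {X ε : Type*}

/-- The difference of the in-degree and the out-degree at `v` of a finite set of directed edges
vanishes for all `v`. -/
def IsBalanced [DecidableEq X] (tail head : ε → X) (E : Finset ε) : Prop :=
  ∀ v, ∑ e ∈ E, ((if head e = v then 1 else 0) - (if tail e = v then 1 else 0) : ℤ) = 0

/-- A simple directed cycle of length `m`, continued periodically. -/
structure IsSimpleCycle (tail head : ε → X) (m : ℕ) (f : ℕ → ε) : Prop where
  pos : 0 < m
  head_eq : ∀ k, head (f k) = tail (f (k + 1))
  periodic : f m = f 0
  injOn : Set.InjOn (fun k => tail (f k)) (Set.Iio m)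

variable {tail head : ε → X}

theorem IsSimpleCycle.injOn_edge {m : ℕ} {f : ℕ → ε}
    (hf : IsSimpleCycle tail head m f) :
    Set.InjOn f (Finset.range m) := by
  intro a ha b hb hab
  refine hf.injOn (by simpa using ha) (by simpa using hb) ?_
  simp [hab]

variable [DecidableEq X]

/-- Without such an edge no summand at `head e` is negative, while `e` itself contributes `1`. -/
theorem IsBalanced.exists_succ {E : Finset ε} (hE : IsBalanced tail head E) {e : ε} (he : e ∈ E) :
    ∃ e' ∈ E, tail e' = head e := by
  by_contra! h
  have h0 := hE (head e)
  have hpos : 0 < ∑ e' ∈ E,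
      ((if head e' = head e then 1 else 0) - (if tail e' = head e then 1 else 0) : ℤ) := by
    refine Finset.sum_pos' (fun i hi => ?_) ⟨e, he, ?_⟩
    · rw [if_neg (h i hi)]
      split_ifs <;> simp
    · rw [if_neg (h e he)]
      simp
  omega

/-- The heads are the tails shifted by one step, so over a period both have the same count at `v`.
-/
theorem IsSimpleCycle.isBalanced [DecidableEq ε] {m : ℕ} {f : ℕ → ε}
    (hf : IsSimpleCycle tail head m f) :
    IsBalanced tail head ((Finset.range m).image f) := by
  intro v
  rw [Finset.sum_image hf.injOn_edge, Finset.sum_sub_distrib]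
  simp_rw [hf.head_eq]
  have := Finset.sum_range_succ' (fun k => (if tail (f k) = v then 1 else 0 : ℤ)) m
  rw [Finset.sum_range_succ, hf.periodic] at this
  omega

theorem IsBalanced.sdiff [DecidableEq ε] {E C : Finset ε} (hE : IsBalanced tail head E)
    (hC : IsBalanced tail head C) (h : C ⊆ E) : IsBalanced tail head (E \ C) := by
  intro v
  have := Finset.sum_sdiff h (f := fun e =>
    ((if head e = v then 1 else 0) - (if tail e = v then 1 else 0) : ℤ))
  rw [hE v, hC v] at this
  simpa using this

/-- Choosing one outgoing edge at every tail defines a self-map of a finite set of vertices. Some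
orbit reaches a periodic point, and its minimal period makes the tails along the cycle distinct. -/
theorem IsBalanced.exists_isSimpleCycle {E : Finset ε} (hE : IsBalanced tail head E)
    (hne : E.Nonempty) : ∃ m f, IsSimpleCycle tail head m f ∧ ∀ k, f k ∈ E := by
  have hs : ∀ e : E, ∃ e' : E, tail e' = head e := fun e => by
    obtain ⟨e', h, h'⟩ := hE.exists_succ e.2
    exact ⟨⟨e', h⟩, h'⟩
  let Y := E.image tail
  have hout : ∀ v : Y, ∃ e : E, tail e = v := fun v => by
    obtain ⟨e, he, h⟩ := Finset.mem_image.1 v.2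
    exact ⟨⟨e, he⟩, h⟩
  choose out hout using hout
  choose nxt hnxt using hs
  let g : Y → Y := fun v => ⟨tail (nxt (out v)), Finset.mem_image_of_mem _ (nxt (out v)).2⟩
  obtain ⟨e0, he0⟩ := hne
  let y0 : Y := ⟨tail e0, Finset.mem_image_of_mem _ he0⟩
  obtain ⟨a, b, hab, heq⟩ := Finite.exists_ne_map_eq_of_infinite (fun k => g^[k] y0)
  wlog hlt : a < b generalizing a b
  · exact this b a hab.symm heq.symm (by omega)
  set y := g^[a] y0 with hy
  have hper : Function.IsPeriodicPt g (b - a) y := by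
    rw [Function.IsPeriodicPt, Function.IsFixedPt, hy, ← Function.iterate_add_apply,
      Nat.sub_add_cancel hlt.le, ← heq]
  have hpos : 0 < Function.minimalPeriod g y := hper.minimalPeriod_pos (by omega)
  refine ⟨Function.minimalPeriod g y, fun k => out (g^[k] y), ⟨hpos, fun k => ?_, ?_, ?_⟩,
    fun k => (out _).2⟩
  · rw [hout, Function.iterate_succ_apply', ← hnxt]
  · simp [Function.iterate_minimalPeriod]
  · intro i hi j hj hij
    simp only [hout] at hij
    exact Function.iterate_injOn_Iio_minimalPeriod hi hj (Subtype.ext hij)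

/-- Induction over balanced sets of edges by removing simple cycles. -/
theorem IsBalanced.induction [DecidableEq ε] {p : Finset ε → Prop} (h0 : p ∅)
    (h1 : ∀ (E : Finset ε) (m : ℕ) (f : ℕ → ε), IsSimpleCycle tail head m f →
      Disjoint E ((Finset.range m).image f) → p E → p (E ∪ (Finset.range m).image f))
    {E : Finset ε} (hE : IsBalanced tail head E) : p E := by
  induction E using Finset.strongInduction with
  | H E ih =>
    rcases E.eq_empty_or_nonempty with rfl | hne
    · exact h0
    · obtain ⟨m, f, hf, hfE⟩ := hE.exists_isSimpleCycle hne
      have hsub : (Finset.range m).image f ⊆ E := by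
        intro e he
        obtain ⟨k, -, rfl⟩ := Finset.mem_image.1 he
        exact hfE k
      rw [← Finset.sdiff_union_of_subset hsub]
      refine h1 _ m f hf Finset.sdiff_disjoint (ih _ ?_ (hE.sdiff hf.isBalanced hsub))
      exact Finset.sdiff_ssubset hsub ⟨f 0, Finset.mem_image_of_mem _ (by simpa using hf.pos)⟩

end Digraph

/-! ### Edges of the unit grid -/

/-- An edge of the unit grid, directed such that the square whose lower left corner is `e.1` lies to
its left; `e.2` numbers the sides of this square counterclockwise, starting at the bottom. -/
abbrev GridEdge := (ℤ × ℤ) × Fin 4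

/-- The corners of the unit square. -/
def corner : Fin 4 → ℤ × ℤ := ![(0, 0), (1, 0), (1, 1), (0, 1)]

/-- The square to the right of a side of the unit square. -/
def neighbour : Fin 4 → ℤ × ℤ := ![(0, -1), (1, 0), (0, 1), (-1, 0)]

namespace GridEdge

/-- The starting point of an edge. -/
def tail (e : GridEdge) : ℤ × ℤ := e.1 + corner e.2

/-- The end point of an edge. -/
def head (e : GridEdge) : ℤ × ℤ := e.1 + corner (e.2 + 1)

/-- The reversed edge. -/
def rev (e : GridEdge) : GridEdge := (e.1 + neighbour e.2, e.2 + 2)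

theorem rev_rev (e : GridEdge) : e.rev.rev = e := by
  obtain ⟨⟨m, n⟩, i⟩ := e
  fin_cases i <;> simp [rev, neighbour]

theorem rev_ne (e : GridEdge) : e.rev ≠ e := by
  obtain ⟨⟨m, n⟩, i⟩ := e
  fin_cases i <;> simp [rev, neighbour]

theorem tail_rev (e : GridEdge) : e.rev.tail = e.head := by
  obtain ⟨⟨m, n⟩, i⟩ := e
  fin_cases i <;> simp [rev, neighbour, tail, head, corner]

theorem head_rev (e : GridEdge) : e.rev.head = e.tail := by
  rw [← tail_rev, rev_rev]

end GridEdge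

/-- The boundary edges of a finite union of squares. -/
def boundaryEdges (S : Finset (ℤ × ℤ)) : Finset GridEdge :=
  (S ×ˢ Finset.univ).filter fun e => e.rev.1 ∉ S

theorem mem_boundaryEdges {S : Finset (ℤ × ℤ)} {e : GridEdge} :
    e ∈ boundaryEdges S ↔ e.1 ∈ S ∧ e.rev.1 ∉ S := by
  simp [boundaryEdges]

/-- Inner edges cancel in the sum of the boundaries of squares. -/
theorem sum_boundaryEdges {M : Type*} [AddCommGroup M] (S : Finset (ℤ × ℤ)) (F : GridEdge → M)
    (hF : ∀ e : GridEdge, F e.rev = -F e) :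
    ∑ e ∈ boundaryEdges S, F e = ∑ s ∈ S, ∑ i, F (s, i) := by
  rw [← Finset.sum_product', ← Finset.sum_filter_add_sum_filter_not (S ×ˢ Finset.univ)
    (fun e : GridEdge => e.rev.1 ∉ S), boundaryEdges, left_eq_add]
  -- Reversal is a fixed-point-free involution of the edges with squares of `S` on both sides.
  refine Finset.sum_involution (fun e _ => GridEdge.rev e) (fun e _ => by simp [hF])
    (fun e _ _ => GridEdge.rev_ne e) (fun e he => ?_) (fun e _ => GridEdge.rev_rev e)
  simp only [Finset.mem_filter, Finset.mem_product, Finset.mem_univ, and_true, not_not] at he ⊢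
  exact ⟨he.2, by rw [GridEdge.rev_rev]; exact he.1⟩

/-- The degree difference changes sign under reversal, so inner edges cancel, and the four sides of
a single square form a cycle. -/
theorem isBalanced_boundaryEdges (S : Finset (ℤ × ℤ)) :
    IsBalanced GridEdge.tail GridEdge.head (boundaryEdges S) := by
  intro v
  rw [sum_boundaryEdges S _ fun e => by rw [e.tail_rev, e.head_rev, neg_sub]]
  refine Finset.sum_eq_zero fun s _ => ?_
  rw [Finset.sum_sub_distrib, sub_eq_zero]
  exact Fintype.sum_equiv (Equiv.addRight 1) _ _ fun i => by
    simp only [GridEdge.tail, GridEdge.head, Equiv.coe_addRight]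
    congr

/-! ### Smoothly parametrized polygonal curves -/

/-- With `g = expNegInvGlue` the transition is `g x / (g x + g (1 - x))`, and `g` is strictly
increasing on `[0, ∞)`. Strictness makes the polygonal curves injective. -/
theorem strictMonoOn_smoothTransition : StrictMonoOn Real.smoothTransition (Icc 0 1) := by
  have key : ∀ x y : ℝ, 0 ≤ x → x < y → expNegInvGlue x < expNegInvGlue y := by
    intro x y hx hxy
    rcases hx.eq_or_lt with rfl | hx
    · simpa using expNegInvGlue.pos_of_pos hxy
    · simp only [expNegInvGlue, hx.not_ge, (hx.trans hxy).not_ge, if_false, Real.exp_lt_exp,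
        neg_lt_neg_iff]
      exact (inv_lt_inv₀ (hx.trans hxy) hx).2 hxy
  intro x hx y hy hxy
  have h1 := key x y hx.1 hxy
  have h2 := key (1 - y) (1 - x) (by linarith [hy.2]) (by linarith)
  have h3 := expNegInvGlue.nonneg x
  have h4 := expNegInvGlue.nonneg (1 - y)
  simp only [Real.smoothTransition]
  rw [div_lt_div_iff₀ (Real.smoothTransition.pos_denom x) (Real.smoothTransition.pos_denom y)]
  nlinarith [mul_le_mul_of_nonneg_left h2.le h3]

/-- The polygonal curve through `p 0, …, p M`, which passes through `p k` with velocity zero at the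
time `k`. -/
def polyline (p : ℕ → ℂ) (M : ℕ) (u : ℝ) : ℂ :=
  p 0 + ∑ k ∈ Finset.range M, Real.smoothTransition (u - k) • (p (k + 1) - p k)

variable {p : ℕ → ℂ} {M : ℕ}

theorem contDiff_polyline : ContDiff ℝ 1 (polyline p M) := by
  refine contDiff_const.add (ContDiff.sum fun k _ => ContDiff.fun_smul ?_ contDiff_const)
  exact (Real.smoothTransition.contDiff (n := 1)).comp (contDiff_id.sub contDiff_const)

/-- At such a time the transitions of index below `k` have reached `1` and telescope, while those of
index above `k` are still `0`. -/
theorem polyline_eq {k : ℕ} (hk : k < M) {u : ℝ} (hu : u ∈ Icc (k : ℝ) (k + 1)) :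
    polyline p M u = p k + Real.smoothTransition (u - k) • (p (k + 1) - p k) := by
  obtain ⟨r, rfl⟩ := Nat.exists_eq_add_of_lt hk
  rw [polyline, show k + r + 1 = k + 1 + r by ring, Finset.sum_range_add, Finset.sum_range_succ]
  have h1 : ∑ j ∈ Finset.range k, Real.smoothTransition (u - j) • (p (j + 1) - p j)
      = p k - p 0 := by
    rw [← Finset.sum_range_sub]
    refine Finset.sum_congr rfl fun j hj => ?_
    rw [Real.smoothTransition.one_of_one_le, one_smul]
    have : ((j + 1 : ℕ) : ℝ) ≤ k := by exact_mod_cast Finset.mem_range.1 hj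
    push_cast at this
    linarith [hu.1]
  have h2 : ∑ j ∈ Finset.range r,
      Real.smoothTransition (u - (k + 1 + j : ℕ)) • (p (k + 1 + j + 1) - p (k + 1 + j)) = 0 := by
    refine Finset.sum_eq_zero fun j _ => ?_
    rw [Real.smoothTransition.zero_of_nonpos, zero_smul]
    push_cast
    have : (0 : ℝ) ≤ j := j.cast_nonneg
    linarith [hu.2]
  rw [h1, h2]
  ring

theorem polyline_nat {k : ℕ} (hk : k ≤ M) : polyline p M k = p k := by
  rcases hk.lt_or_eq with hk | rfl
  · simp [polyline_eq hk (u := k) (by simp)]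
  · rcases Nat.eq_zero_or_pos k with rfl | hpos
    · simp [polyline]
    · obtain ⟨j, rfl⟩ := Nat.exists_eq_succ_of_ne_zero hpos.ne'
      rw [polyline_eq (Nat.lt_succ_self j) (by simp)]
      simp

theorem exists_nat_mem_Ico {u : ℝ} (hu : u ∈ Ico (0 : ℝ) M) :
    ∃ k < M, u ∈ Ico (k : ℝ) (k + 1) :=
  ⟨⌊u⌋₊, (Nat.floor_lt hu.1).2 hu.2, Nat.floor_le hu.1, Nat.lt_floor_add_one u⟩

theorem image_smoothTransition (k : ℕ) :
    (fun u : ℝ => Real.smoothTransition (u - k)) '' Icc (k : ℝ) (k + 1) = Icc 0 1 := by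
  refine Subset.antisymm ?_ ?_
  · rintro _ ⟨u, -, rfl⟩
    exact ⟨Real.smoothTransition.nonneg _, Real.smoothTransition.le_one _⟩
  · have := intermediate_value_Icc (f := fun u : ℝ => Real.smoothTransition (u - k))
      (show (k : ℝ) ≤ k + 1 by linarith)
      (Real.smoothTransition.continuous.comp (by fun_prop)).continuousOn
    simpa using this

theorem image_polyline_piece {k : ℕ} (hk : k < M) :
    polyline p M '' Icc (k : ℝ) (k + 1) = segment ℝ (p k) (p (k + 1)) := by
  rw [segment_eq_image', ← image_smoothTransition k, image_image]
  exact image_congr fun u hu => polyline_eq hk hu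

theorem image_polyline (hM : 0 < M) :
    polyline p M '' Icc (0 : ℝ) M = ⋃ k ∈ Finset.range M, segment ℝ (p k) (p (k + 1)) := by
  have : Icc (0 : ℝ) M = ⋃ k ∈ Finset.range M, Icc (k : ℝ) (k + 1) := by
    ext u
    simp only [Finset.mem_range, mem_iUnion, exists_prop]
    constructor
    · intro hu
      rcases hu.2.lt_or_eq with h | rfl
      · obtain ⟨k, hk, h⟩ := exists_nat_mem_Ico ⟨hu.1, h⟩
        exact ⟨k, hk, Ico_subset_Icc_self h⟩
      · obtain ⟨j, rfl⟩ := Nat.exists_eq_succ_of_ne_zero hM.ne'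
        exact ⟨j, Nat.lt_succ_self j, by simp⟩
    · rintro ⟨k, hk, h⟩
      have : ((k + 1 : ℕ) : ℝ) ≤ M := by exact_mod_cast hk
      push_cast at this
      exact ⟨(Nat.cast_nonneg k).trans h.1, h.2.trans this⟩
  rw [this, image_iUnion₂]
  exact iUnion₂_congr fun k hk => image_polyline_piece (Finset.mem_range.1 hk)

/-- The hypothesis concerns linear parametrizations of the half-open sides; strict monotonicity of
the transition carries injectivity over to the slowed-down curve. -/
theorem injOn_polyline
    (h : ∀ j < M, ∀ k < M, ∀ s ∈ Ico (0 : ℝ) 1, ∀ t ∈ Ico (0 : ℝ) 1,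
      p j + s • (p (j + 1) - p j) = p k + t • (p (k + 1) - p k) → j = k ∧ s = t) :
    InjOn (polyline p M) (Ico 0 M) := by
  intro u hu v hv huv
  obtain ⟨j, hj, huj⟩ := exists_nat_mem_Ico hu
  obtain ⟨k, hk, hvk⟩ := exists_nat_mem_Ico hv
  rw [polyline_eq hj (Ico_subset_Icc_self huj), polyline_eq hk (Ico_subset_Icc_self hvk)] at huv
  obtain ⟨rfl, hst⟩ := h j hj k hk _
    ⟨Real.smoothTransition.nonneg _, Real.smoothTransition.lt_one_of_lt_one (by linarith [huj.2])⟩ _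
    ⟨Real.smoothTransition.nonneg _, Real.smoothTransition.lt_one_of_lt_one (by linarith [hvk.2])⟩
    huv
  have := strictMonoOn_smoothTransition.injOn ⟨sub_nonneg.2 huj.1, by linarith [huj.2]⟩
    ⟨sub_nonneg.2 hvk.1, by linarith [hvk.2]⟩ hst
  linarith

/-- The integral of `1 / (z - w)` over the segment from `a` to `b`. -/
def segIntegral (a b w : ℂ) : ℂ := ∫ s in (0 : ℝ)..1, (b - a) / (a + s • (b - a) - w)

theorem segIntegral_symm (a b w : ℂ) : segIntegral b a w = -segIntegral a b w := by
  have := intervalIntegral.integral_comp_sub_left (a := 0) (b := 1)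
    (fun s : ℝ => (b - a) / (a + s • (b - a) - w)) 1
  simp only [sub_zero, sub_self] at this
  rw [segIntegral, segIntegral, ← this, ← intervalIntegral.integral_neg]
  refine intervalIntegral.integral_congr fun s _ => ?_
  simp only [Complex.real_smul, Complex.ofReal_sub, Complex.ofReal_one]
  rw [show a + (1 - (s : ℂ)) * (b - a) - w = b + s * (a - b) - w by ring, ← neg_div, neg_sub]

/-- Substitution `s = smoothTransition (u - k)`: the integral over a side does not see its
parametrization. -/
theorem integral_polyline_piece {k : ℕ} (hk : k < M) {w : ℂ}
    (hw : w ∉ segment ℝ (p k) (p (k + 1))) :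
    ∫ u in (k : ℝ)..(k + 1), deriv (polyline p M) u / (polyline p M u - w)
      = segIntegral (p k) (p (k + 1)) w := by
  have hle : (k : ℝ) ≤ k + 1 := by linarith
  have hcd : ContDiff ℝ 1 fun u : ℝ => Real.smoothTransition (u - k) :=
    (Real.smoothTransition.contDiff (n := 1)).comp (contDiff_id.sub contDiff_const)
  have hder : ∀ u : ℝ, HasDerivAt (fun u : ℝ => Real.smoothTransition (u - k))
      (deriv (fun u : ℝ => Real.smoothTransition (u - k)) u) u :=
    fun u => (hcd.differentiable one_ne_zero u).hasDerivAt
  have hsub := intervalIntegral.integral_deriv_smul_comp'' (a := (k : ℝ)) (b := k + 1)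
    (f := fun u : ℝ => Real.smoothTransition (u - k))
    (f' := deriv fun u : ℝ => Real.smoothTransition (u - k))
    (g := fun s : ℝ => (p (k + 1) - p k) / (p k + s • (p (k + 1) - p k) - w))
    hcd.continuous.continuousOn (fun u _ => (hder u).hasDerivWithinAt)
    (hcd.continuous_deriv le_rfl).continuousOn ?_
  · simp only [sub_self, Real.smoothTransition.zero, add_sub_cancel_left,
      Real.smoothTransition.one] at hsub
    rw [segIntegral, ← hsub]
    -- Only interior times are compared, since only there does the formula for this side hold on a
    -- whole neighbourhood.
    refine intervalIntegral.integral_congr_Ioo_of_le hle fun u hu => ?_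
    have hev : polyline p M =ᶠ[nhds u]
        fun u => p k + Real.smoothTransition (u - k) • (p (k + 1) - p k) := by
      filter_upwards [Ioo_mem_nhds hu.1 hu.2] with v hv
      exact polyline_eq hk (Ioo_subset_Icc_self hv)
    have hd := (((hder u).smul_const (p (k + 1) - p k)).const_add (p k)).congr_of_eventuallyEq hev
    simp only [Function.comp]
    rw [hd.deriv, hev.self_of_nhds, smul_div_assoc]
  · rw [uIcc_of_le hle, image_smoothTransition]
    refine ContinuousOn.div continuousOn_const (by fun_prop) fun s hs h0 => hw ?_
    rw [segment_eq_image']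
    exact ⟨s, hs, sub_eq_zero.1 h0⟩

/-- `polyline p M`, parametrized by `[0, 1]`. -/
def polygon (p : ℕ → ℂ) (M : ℕ) (t : ℝ) : ℂ := polyline p M (M * t)

theorem image_polygon (hM : 0 < M) :
    polygon p M '' Icc (0 : ℝ) 1 = ⋃ k ∈ Finset.range M, segment ℝ (p k) (p (k + 1)) := by
  have hM' : (0 : ℝ) < M := by exact_mod_cast hM
  rw [← image_polyline hM, show polygon p M = polyline p M ∘ fun t => (M : ℝ) * t from rfl,
    image_comp, image_mul_left_Icc' hM']
  simp

theorem isC1JordanCurve_polygon (hM : 0 < M) (hp : p M = p 0)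
    (h : ∀ j < M, ∀ k < M, ∀ s ∈ Ico (0 : ℝ) 1, ∀ t ∈ Ico (0 : ℝ) 1,
      p j + s • (p (j + 1) - p j) = p k + t • (p (k + 1) - p k) → j = k ∧ s = t) :
    IsC1JordanCurve (polygon p M) := by
  have hM' : (0 : ℝ) < M := by exact_mod_cast hM
  refine ⟨?_, ?_, ?_⟩
  · exact (contDiff_polyline.comp (contDiff_const.mul contDiff_id)).contDiffOn
  · have h0 := polyline_nat (p := p) (Nat.zero_le M)
    have h1 := polyline_nat (p := p) (le_refl M)
    simp only [Nat.cast_zero] at h0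
    simp [polygon, h0, h1, hp]
  · intro s hs t ht hst
    have := injOn_polyline h (x₁ := M * s) (x₂ := M * t)
      ⟨mul_nonneg hM'.le hs.1, by nlinarith [hs.2]⟩
      ⟨mul_nonneg hM'.le ht.1, by nlinarith [ht.2]⟩ hst
    exact mul_left_cancel₀ hM'.ne' this

theorem integral_polygon (hM : 0 < M) {w : ℂ}
    (hw : ∀ k < M, w ∉ segment ℝ (p k) (p (k + 1))) :
    ∫ t in (0 : ℝ)..1, deriv (polygon p M) t / (polygon p M t - w)
      = ∑ k ∈ Finset.range M, segIntegral (p k) (p (k + 1)) w := by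
  have hM' : (M : ℝ) ≠ 0 := by exact_mod_cast hM.ne'
  have hd : ∀ t, deriv (polygon p M) t = (M : ℝ) • deriv (polyline p M) (M * t) := fun t =>
    deriv_comp_mul_left (M : ℝ) (polyline p M) t
  simp only [hd, smul_div_assoc]
  rw [intervalIntegral.integral_smul]
  simp only [polygon]
  rw [intervalIntegral.smul_integral_comp_mul_left
    (f := fun u => deriv (polyline p M) u / (polyline p M u - w))]
  have hne : ∀ u ∈ Icc (0 : ℝ) M, polyline p M u - w ≠ 0 := by
    intro u hu h0
    have : polyline p M u ∈ polyline p M '' Icc (0 : ℝ) M := mem_image_of_mem _ hu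
    rw [image_polyline hM, sub_eq_zero.1 h0] at this
    simp only [mem_iUnion, Finset.mem_range] at this
    obtain ⟨k, hk, h⟩ := this
    exact hw k hk h
  have hcont : ContinuousOn (fun u => deriv (polyline p M) u / (polyline p M u - w))
      (Icc (0 : ℝ) M) :=
    ((contDiff_polyline.continuous_deriv le_rfl).continuousOn).div
      (contDiff_polyline.continuous.sub continuous_const).continuousOn hne
  have hsum := intervalIntegral.sum_integral_adjacent_intervals (a := fun k : ℕ => (k : ℝ)) (n := M)
    (μ := MeasureTheory.volume)
    (f := fun u => deriv (polyline p M) u / (polyline p M u - w)) fun k hk => by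
      refine ContinuousOn.intervalIntegrable (hcont.mono ?_)
      rw [uIcc_of_le (by simp)]
      refine Icc_subset_Icc (Nat.cast_nonneg k) ?_
      exact_mod_cast hk
  simp only [Nat.cast_zero] at hsum
  rw [mul_zero, mul_one, ← hsum]
  refine Finset.sum_congr rfl fun k hk => ?_
  have hk := Finset.mem_range.1 hk
  rw [← integral_polyline_piece hk (hw k hk)]
  push_cast
  rfl

/-! ### Cauchy-type integrals and contour integrals of a resolvent. -/

open MeasureTheory in
/-- Integrals of Cauchy type are holomorphic off the curve. -/
theorem differentiableAt_cauchyIntegral {E : Type*} [NormedAddCommGroup E] [NormedSpace ℂ E]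
    {γ : ℝ → ℂ} (hγ : ContinuousOn γ (Icc 0 1)) {φ : ℝ → E}
    (hφ : IntervalIntegrable φ volume 0 1) {w : ℂ} (hw : w ∉ γ '' Icc 0 1) :
    DifferentiableAt ℂ (fun w => ∫ t in (0 : ℝ)..1, (γ t - w)⁻¹ • φ t) w := by
  have hcomp : IsCompact (γ '' Icc 0 1) := isCompact_Icc.image_of_continuousOn hγ
  obtain ⟨r, hr, hball⟩ := Metric.isOpen_iff.1 hcomp.isClosed.isOpen_compl w hw
  have hnorm : ∀ t ∈ Icc (0 : ℝ) 1, ∀ x ∈ Metric.ball w (r / 2), r / 2 ≤ ‖γ t - x‖ := by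
    intro t ht x hx
    have h1 : ¬ dist (γ t) w < r := fun h => hball h (mem_image_of_mem _ ht)
    have h2 := dist_triangle (γ t) x w
    rw [Metric.mem_ball] at hx
    rw [← dist_eq_norm]
    linarith
  have hne : ∀ t ∈ Icc (0 : ℝ) 1, ∀ x ∈ Metric.ball w (r / 2), γ t - x ≠ 0 := fun t ht x hx h => by
    have := hnorm t ht x hx
    rw [h, norm_zero] at this
    linarith
  have hball' : Metric.ball w (r / 2) ∈ nhds w := Metric.ball_mem_nhds w (by positivity)
  have hint : ∀ x ∈ Metric.ball w (r / 2),
      IntervalIntegrable (fun t => (γ t - x)⁻¹ • φ t) volume 0 1 := fun x hx => by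
    refine hφ.continuousOn_smul ?_
    rw [uIcc_of_le zero_le_one]
    exact (hγ.sub continuousOn_const).inv₀ fun t ht => hne t ht x hx
  have hint' : IntervalIntegrable (fun t => ((γ t - w) ^ 2)⁻¹ • φ t) volume 0 1 := by
    refine hφ.continuousOn_smul ?_
    rw [uIcc_of_le zero_le_one]
    exact ((hγ.sub continuousOn_const).pow 2).inv₀ fun t ht =>
      pow_ne_zero 2 (hne t ht w (Metric.mem_ball_self (by positivity)))
  have hIoc : ∀ t ∈ uIoc (0 : ℝ) 1, t ∈ Icc (0 : ℝ) 1 := fun t ht => by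
    rw [uIoc_of_le zero_le_one] at ht
    exact Ioc_subset_Icc_self ht
  -- On the ball of radius `r / 2` around `w` the curve keeps distance at least `r / 2`, which
  -- dominates the differentiated kernel.
  refine (intervalIntegral.hasDerivAt_integral_of_dominated_loc_of_deriv_le
    (F := fun x t => (γ t - x)⁻¹ • φ t) (F' := fun x t => ((γ t - x) ^ 2)⁻¹ • φ t)
    (bound := fun t => ((r / 2) ^ 2)⁻¹ * ‖φ t‖) hball' ?_
    (hint w (Metric.mem_ball_self (by positivity)))
    (intervalIntegrable_iff.1 hint').aestronglyMeasurable ?_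
    (hφ.norm.const_mul _) ?_).2.differentiableAt
  · filter_upwards [hball'] with x hx using
      (intervalIntegrable_iff.1 (hint x hx)).aestronglyMeasurable
  · refine Filter.Eventually.of_forall fun t ht x hx => ?_
    rw [norm_smul, norm_inv, norm_pow]
    gcongr
    exact hnorm t (hIoc t ht) x hx
  · refine Filter.Eventually.of_forall fun t ht x hx => ?_
    have h :=
      (((hasDerivAt_id x).const_sub (γ t)).fun_inv (hne t (hIoc t ht) x hx)).smul_const (φ t)
    simpa using h

/-- The curve is `C¹` only within `[0, 1]`, so `deriv` may take a default value at the end points;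
off this null set it is the continuous one-sided derivative. -/
theorem IsC1JordanCurve.intervalIntegrable_deriv {γ : ℝ → ℂ} (h : IsC1JordanCurve γ) :
    IntervalIntegrable (deriv γ) MeasureTheory.volume 0 1 := by
  have hc : ContinuousOn (derivWithin γ (Icc 0 1)) (uIcc (0 : ℝ) 1) := by
    rw [uIcc_of_le zero_le_one]
    exact h.contDiffOn.continuousOn_derivWithin (uniqueDiffOn_Icc zero_lt_one) le_rfl
  refine hc.intervalIntegrable.congr_uIoo fun t ht => ?_
  rw [uIoo_of_le zero_le_one] at ht
  exact derivWithin_of_mem_nhds (Icc_mem_nhds ht.1 ht.2)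

theorem IsC1JordanCurve.intervalIntegrable_smul_resolvent {A : Type*} [NormedRing A]
    [NormedAlgebra ℂ A] [CompleteSpace A] {a : A} {γ : ℝ → ℂ} (h : IsC1JordanCurve γ)
    (hres : ∀ t ∈ Icc (0 : ℝ) 1, γ t ∈ resolventSet ℂ a) :
    IntervalIntegrable (fun t => deriv γ t • resolvent a (γ t)) MeasureTheory.volume 0 1 := by
  refine h.intervalIntegrable_deriv.smul_continuousOn ?_
  rw [uIcc_of_le zero_le_one]
  intro t ht
  exact (spectrum.hasDerivAt_resolvent_const_left (hres t ht)).continuousAt.comp_continuousWithinAt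
    (h.contDiffOn.continuousOn t ht)

/-- The first resolvent identity: insert `(s - a) - (w - a)` between the two resolvents. -/
theorem resolvent_mul_resolvent {A : Type*} [Ring A] [Algebra ℂ A] {a : A} {s w : ℂ}
    (hs : s ∈ resolventSet ℂ a) (hw : w ∈ resolventSet ℂ a) (hne : s - w ≠ 0) :
    resolvent a w * resolvent a s = (s - w)⁻¹ • (resolvent a w - resolvent a s) := by
  have hs' : (algebraMap ℂ A s - a) * resolvent a s = 1 := Ring.mul_inverse_cancel _ hs
  have hw' : resolvent a w * (algebraMap ℂ A w - a) = 1 := Ring.inverse_mul_cancel _ hw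
  rw [eq_inv_smul_iff₀ hne]
  calc (s - w) • (resolvent a w * resolvent a s)
      = resolvent a w * ((algebraMap ℂ A s - a) - (algebraMap ℂ A w - a)) * resolvent a s := by
        rw [sub_sub_sub_cancel_right, ← map_sub, ← Algebra.commutes, ← Algebra.smul_def,
          smul_mul_assoc]
    _ = resolvent a w * ((algebraMap ℂ A s - a) * resolvent a s)
        - (resolvent a w * (algebraMap ℂ A w - a)) * resolvent a s := by noncomm_ring
    _ = _ := by rw [hs', hw', mul_one, one_mul]

open MeasureTheory in
/-- If finitely many curves in the resolvent set have the constant winding number `c` around the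
spectrum of `a`, then the integral of the resolvent over these curves is `2 π i c`. -/
theorem sum_integral_resolvent {A : Type*} [NormedRing A] [NormedAlgebra ℂ A] [CompleteSpace A]
    (a : A) {n : ℕ} {γ : Fin n → ℝ → ℂ} (hγ : ∀ k, IsC1JordanCurve (γ k))
    (hres : ∀ k, ∀ t ∈ Icc (0 : ℝ) 1, γ k t ∈ resolventSet ℂ a) {D : Set ℂ} (hD : IsOpen D)
    (hsub : spectrum ℂ a ⊆ D) (hdisj : ∀ k, ∀ t ∈ Icc (0 : ℝ) 1, γ k t ∉ D) {c : ℂ}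
    (hc : ∀ w ∈ D, windingNumber γ w = c) :
    ∑ k, ∫ t in (0 : ℝ)..1, deriv (γ k) t • resolvent a (γ k t)
      = (2 * Real.pi * Complex.I * c) • (1 : A) := by
  set G : A := ∑ k, ∫ t in (0 : ℝ)..1, deriv (γ k) t • resolvent a (γ k t) with hG
  -- `K` makes sense at every point off the curves, in particular on the spectrum.
  set K : ℂ → A := fun w =>
    -∑ k, ∫ t in (0 : ℝ)..1, (γ k t - w)⁻¹ • (deriv (γ k) t • resolvent a (γ k t)) with hK
  have hint : ∀ k, IntervalIntegrable (fun t => deriv (γ k) t • resolvent a (γ k t)) volume 0 1 :=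
    fun k => (hγ k).intervalIntegrable_smul_resolvent (hres k)
  have hne : ∀ w ∈ D, ∀ k, ∀ t ∈ Icc (0 : ℝ) 1, γ k t - w ≠ 0 := fun w hw k t ht h =>
    hdisj k t ht (by rwa [sub_eq_zero.1 h])
  have hinv : ∀ w ∈ D, ∀ k, ContinuousOn (fun t => (γ k t - w)⁻¹) (uIcc 0 1) := fun w hw k => by
    rw [uIcc_of_le zero_le_one]
    exact ((hγ k).contDiffOn.continuousOn.sub continuousOn_const).inv₀ (hne w hw k)
  -- The resolvent identity splits `R(w) G` into a winding number term, which is `2πi c R(w)`, and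
  -- the Cauchy-type integral `K w`.
  have key : ∀ w ∈ D, w ∈ resolventSet ℂ a →
      resolvent a w * (G - (2 * Real.pi * Complex.I * c) • (1 : A)) = K w := by
    intro w hw hwr
    have hmul : ∀ k, resolvent a w * ∫ t in (0 : ℝ)..1, deriv (γ k) t • resolvent a (γ k t)
        = (∫ t in (0 : ℝ)..1, deriv (γ k) t / (γ k t - w)) • resolvent a w
          - ∫ t in (0 : ℝ)..1, (γ k t - w)⁻¹ • (deriv (γ k) t • resolvent a (γ k t)) := by
      intro k
      rw [← intervalIntegral.integral_smul_const, ← intervalIntegral.integral_sub]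
      · have := (ContinuousLinearMap.mul ℂ A (resolvent a w)).intervalIntegral_comp_comm (hint k)
        simp only [ContinuousLinearMap.mul_apply'] at this
        rw [← this]
        refine intervalIntegral.integral_congr fun t ht => ?_
        rw [uIcc_of_le zero_le_one] at ht
        rw [mul_smul_comm, resolvent_mul_resolvent (hres k t ht) hwr (hne w hw k t ht),
          smul_smul, smul_smul, smul_sub, div_eq_mul_inv, mul_comm (γ k t - w)⁻¹]
      · exact (((hγ k).intervalIntegrable_deriv.mul_continuousOn (hinv w hw k)).smul_continuousOn
          continuousOn_const)
      · exact (hint k).continuousOn_smul (hinv w hw k)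
    have hwind : ∑ k, ∫ t in (0 : ℝ)..1, deriv (γ k) t / (γ k t - w)
        = 2 * Real.pi * Complex.I * c := by
      rw [← hc w hw, windingNumber, mul_inv_cancel_left₀ Complex.two_pi_I_ne_zero]
    rw [mul_sub, hG, Finset.mul_sum, Finset.sum_congr rfl fun k _ => hmul k,
      Finset.sum_sub_distrib, ← Finset.sum_smul, hwind, mul_smul_comm, mul_one]
    simp only [hK]
    rw [sub_right_comm, sub_self, zero_sub]
  classical
  -- The two formulas agree on the overlap of `D` with the resolvent set, and together these open
  -- sets cover the plane, so `H` is entire.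
  set H : ℂ → A := fun w => if w ∈ resolventSet ℂ a then
    resolvent a w * (G - (2 * Real.pi * Complex.I * c) • (1 : A)) else K w with hH
  have hHD : ∀ w ∈ D, H w = K w := by
    intro w hw
    by_cases hwr : w ∈ resolventSet ℂ a
    · simp only [hH, if_pos hwr, key w hw hwr]
    · simp only [hH, if_neg hwr]
  have hdiff : Differentiable ℂ H := by
    intro w
    by_cases hwr : w ∈ resolventSet ℂ a
    · refine DifferentiableAt.congr_of_eventuallyEq
        (f := fun w => resolvent a w * (G - (2 * Real.pi * Complex.I * c) • (1 : A)))
        ((spectrum.hasDerivAt_resolvent_const_left hwr).differentiableAt.mul_const _) ?_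
      filter_upwards [(spectrum.isOpen_resolventSet a).mem_nhds hwr] with z hz
      simp only [hH, if_pos hz]
    · have hwD : w ∈ D := hsub hwr
      refine DifferentiableAt.congr_of_eventuallyEq (f := K) ?_ ?_
      · refine (DifferentiableAt.fun_sum fun k _ => ?_).neg
        refine differentiableAt_cauchyIntegral (hγ k).contDiffOn.continuousOn (hint k) ?_
        rintro ⟨t, ht, rfl⟩
        exact hdisj k t ht hwD
      · filter_upwards [hD.mem_nhds hwD] with z hz using hHD z hz
  have hcob : ∀ᶠ w in Bornology.cobounded ℂ, w ∈ resolventSet ℂ a :=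
    by
    filter_upwards [Bornology.isBounded_def.1 (spectrum.isBounded (𝕜 := ℂ) a)] with w hw
    exact not_not.1 hw
  have hlim : Filter.Tendsto H (Filter.cocompact ℂ) (nhds 0) := by
    rw [← Metric.cobounded_eq_cocompact]
    have := (spectrum.resolvent_tendsto_cobounded (𝕜 := ℂ) a).mul_const
      (G - (2 * Real.pi * Complex.I * c) • (1 : A))
    rw [zero_mul] at this
    refine this.congr' ?_
    filter_upwards [hcob] with w hw
    simp only [hH, if_pos hw]
  -- By Liouville `H` vanishes; at a single regular point the invertible factor `R(w)` can be
  -- cancelled.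
  obtain ⟨w, hw⟩ := hcob.exists
  have h0 := hdiff.apply_eq_of_tendsto_cocompact w hlim
  simp only [hH, if_pos hw] at h0
  have hu : IsUnit (resolvent a w) := spectrum.isUnit_resolvent.1 hw
  exact sub_eq_zero.1 ((hu.mul_right_eq_zero).1 h0)

/-! ### The boundary of a union of grid squares -/

/-- A point of the lattice `ℤ + i ℤ`. -/
def latticePt (v : ℤ × ℤ) : ℂ := ⟨v.1, v.2⟩

/-- The closed unit square with lower left corner `s`. -/
def closedSq (s : ℤ × ℤ) : Set ℂ := Icc (s.1 : ℝ) (s.1 + 1) ×ℂ Icc (s.2 : ℝ) (s.2 + 1)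

/-- The open unit square with lower left corner `s`. -/
def openSq (s : ℤ × ℤ) : Set ℂ := Ioo (s.1 : ℝ) (s.1 + 1) ×ℂ Ioo (s.2 : ℝ) (s.2 + 1)

theorem mem_sq {s : ℤ × ℤ} {z : ℂ} :
    z ∈ closedSq s ↔ ((s.1 : ℝ) ≤ z.re ∧ z.re ≤ s.1 + 1) ∧ (s.2 : ℝ) ≤ z.im ∧ z.im ≤ s.2 + 1 :=
  Iff.rfl

theorem mem_openSq {s : ℤ × ℤ} {z : ℂ} :
    z ∈ openSq s ↔ ((s.1 : ℝ) < z.re ∧ z.re < s.1 + 1) ∧ (s.2 : ℝ) < z.im ∧ z.im < s.2 + 1 :=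
  Iff.rfl

theorem isClosed_sq (s : ℤ × ℤ) : IsClosed (closedSq s) := isClosed_Icc.reProdIm isClosed_Icc

theorem closure_openSq (s : ℤ × ℤ) : closure (openSq s) = closedSq s := by
  rw [openSq, Complex.closure_reProdIm, closure_Ioo (by simp), closure_Ioo (by simp), closedSq]

theorem exists_mem_sq (z : ℂ) : ∃ s, z ∈ closedSq s :=
  ⟨(⌊z.re⌋, ⌊z.im⌋), mem_sq.2 ⟨⟨Int.floor_le _, (Int.lt_floor_add_one _).le⟩,
    Int.floor_le _, (Int.lt_floor_add_one _).le⟩⟩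

theorem eq_of_mem_openSq_of_mem_sq {s s' : ℤ × ℤ} {z : ℂ} (h : z ∈ openSq s)
    (h' : z ∈ closedSq s') :
    s = s' := by
  obtain ⟨⟨h1, h2⟩, h3, h4⟩ := mem_openSq.1 h
  obtain ⟨⟨h1', h2'⟩, h3', h4'⟩ := mem_sq.1 h'
  have a1 : s.1 < s'.1 + 1 := by exact_mod_cast h1.trans_le h2'
  have a2 : s'.1 < s.1 + 1 := by exact_mod_cast h1'.trans_lt h2
  have a3 : s.2 < s'.2 + 1 := by exact_mod_cast h3.trans_le h4'
  have a4 : s'.2 < s.2 + 1 := by exact_mod_cast h3'.trans_lt h4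
  ext <;> omega

/-- The segment of an edge. -/
def edgeSeg (e : GridEdge) : Set ℂ := segment ℝ (latticePt e.tail) (latticePt e.head)

theorem edgePt_re (e : GridEdge) (t : ℝ) :
    (latticePt e.tail + t • (latticePt e.head - latticePt e.tail)).re
      = e.tail.1 + t * ((e.head.1 - e.tail.1 : ℤ) : ℝ) := by
  simp [latticePt]

theorem edgePt_im (e : GridEdge) (t : ℝ) :
    (latticePt e.tail + t • (latticePt e.head - latticePt e.tail)).im
      = e.tail.2 + t * ((e.head.2 - e.tail.2 : ℤ) : ℝ) := by
  simp [latticePt]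

/-- Describing an edge by its two adjacent squares reduces the later topology to membership in
squares. The witnessing parameter is the distance from the tail. -/
theorem mem_edgeSeg {e : GridEdge} {z : ℂ} :
    z ∈ edgeSeg e ↔ z ∈ closedSq e.1 ∧ z ∈ closedSq e.rev.1 := by
  rw [edgeSeg, segment_eq_image', mem_sq, mem_sq]
  constructor
  · rintro ⟨t, ⟨h0, h1⟩, rfl⟩
    simp only [edgePt_re, edgePt_im]
    obtain ⟨⟨m, n⟩, i⟩ := e
    fin_cases i <;> simp [GridEdge.tail, GridEdge.head, GridEdge.rev, corner, neighbour] <;>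
      and_intros <;> linarith
  · intro h
    obtain ⟨⟨m, n⟩, i⟩ := e
    fin_cases i <;> simp [GridEdge.rev, neighbour] at h <;>
      obtain ⟨⟨⟨h1, h2⟩, h3, h4⟩, ⟨h5, h6⟩, h7, h8⟩ := h
    · refine ⟨z.re - m, ⟨by linarith, by linarith⟩, Complex.ext ?_ ?_⟩ <;>
        simp only [edgePt_re, edgePt_im] <;>
        simp [GridEdge.tail, GridEdge.head, corner] <;> linarith
    · refine ⟨z.im - n, ⟨by linarith, by linarith⟩, Complex.ext ?_ ?_⟩ <;>
        simp only [edgePt_re, edgePt_im] <;>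
        simp [GridEdge.tail, GridEdge.head, corner] <;> linarith
    · refine ⟨m + 1 - z.re, ⟨by linarith, by linarith⟩, Complex.ext ?_ ?_⟩ <;>
        simp only [edgePt_re, edgePt_im] <;>
        simp [GridEdge.tail, GridEdge.head, corner] <;> linarith
    · refine ⟨n + 1 - z.im, ⟨by linarith, by linarith⟩, Complex.ext ?_ ?_⟩ <;>
        simp only [edgePt_re, edgePt_im] <;>
        simp [GridEdge.tail, GridEdge.head, corner] <;> linarith

theorem GridEdge.head_ne_tail (e : GridEdge) : e.head ≠ e.tail := by
  obtain ⟨⟨m, n⟩, i⟩ := e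
  fin_cases i <;> simp [GridEdge.tail, GridEdge.head, corner]

theorem GridEdge.eq_rev {e e' : GridEdge} (h1 : e.head = e'.tail) (h2 : e.tail = e'.head) :
    e' = e.rev := by
  obtain ⟨⟨m, n⟩, i⟩ := e
  obtain ⟨⟨m', n'⟩, i'⟩ := e'
  fin_cases i <;> fin_cases i' <;>
    simp [GridEdge.tail, GridEdge.head, GridEdge.rev, corner, neighbour] at h1 h2 ⊢ <;> omega

/-- Rounding the coordinates recovers the edge: at `t = 0` both roundings give the tail, and for `0
< t < 1` they give the two end points, in an order fixed by the direction. -/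
theorem floor_ceil_edgePt (e : GridEdge) {t : ℝ} (ht : t ∈ Ico (0 : ℝ) 1) {z : ℂ}
    (hz : latticePt e.tail + t • (latticePt e.head - latticePt e.tail) = z) :
    (e.tail = (⌊z.re⌋, ⌊z.im⌋) ∧ e.tail = (⌈z.re⌉, ⌈z.im⌉)) ∨
    (e.tail = (⌊z.re⌋, ⌊z.im⌋) ∧ e.head = (⌈z.re⌉, ⌈z.im⌉)) ∨
    (e.tail = (⌈z.re⌉, ⌈z.im⌉) ∧ e.head = (⌊z.re⌋, ⌊z.im⌋)) := by
  obtain ⟨h0, h1⟩ := ht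
  have hre := edgePt_re e t
  have him := edgePt_im e t
  rw [hz] at hre him
  rcases h0.eq_or_lt with rfl | h0
  · left
    simp [hre, him]
  · right
    have ft : ⌊t⌋ = 0 := Int.floor_eq_zero_iff.2 ⟨h0.le, h1⟩
    have ct : ⌈t⌉ = 1 := Int.ceil_eq_iff.2 (by simp [h0, h1.le])
    rw [hre, him]
    obtain ⟨⟨m, n⟩, i⟩ := e
    fin_cases i
    · left
      simp [GridEdge.tail, GridEdge.head, corner, ft, ct]
    · left
      simp [GridEdge.tail, GridEdge.head, corner, ft, ct]
    · right
      have h1 : ⌊(m : ℝ) + 1 + -t⌋ = m := Int.floor_eq_iff.2 ⟨by linarith, by linarith⟩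
      have h2 : ⌈(m : ℝ) + 1 + -t⌉ = m + 1 :=
        Int.ceil_eq_iff.2 ⟨by push_cast; linarith, by push_cast; linarith⟩
      simp [GridEdge.tail, GridEdge.head, corner, h1, h2]
    · right
      have h1 : ⌊(n : ℝ) + 1 + -t⌋ = n := Int.floor_eq_iff.2 ⟨by linarith, by linarith⟩
      have h2 : ⌈(n : ℝ) + 1 + -t⌉ = n + 1 :=
        Int.ceil_eq_iff.2 ⟨by push_cast; linarith, by push_cast; linarith⟩
      simp [GridEdge.tail, GridEdge.head, corner, h1, h2]

/-- Two half-open edges which meet start at the same point or are reversed to each other. -/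
theorem tail_eq_or_eq_rev {e e' : GridEdge} {s t : ℝ} (hs : s ∈ Ico (0 : ℝ) 1)
    (ht : t ∈ Ico (0 : ℝ) 1)
    (h : latticePt e.tail + s • (latticePt e.head - latticePt e.tail)
      = latticePt e'.tail + t • (latticePt e'.head - latticePt e'.tail)) :
    e.tail = e'.tail ∨ e' = e.rev := by
  rcases floor_ceil_edgePt e hs rfl with ⟨h1, h2⟩ | ⟨h1, h2⟩ | ⟨h1, h2⟩ <;>
  rcases floor_ceil_edgePt e' ht h.symm with ⟨h1', h2'⟩ | ⟨h1', h2'⟩ | ⟨h1', h2'⟩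
  · exact Or.inl (h1.trans h1'.symm)
  · exact Or.inl (h1.trans h1'.symm)
  · exact Or.inl (h2.trans h1'.symm)
  · exact Or.inl (h1.trans h1'.symm)
  · exact Or.inl (h1.trans h1'.symm)
  · exact Or.inr (GridEdge.eq_rev (h2.trans h1'.symm) (h1.trans h2'.symm))
  · exact Or.inl (h1.trans h2'.symm)
  · exact Or.inr (GridEdge.eq_rev (h2.trans h1'.symm) (h1.trans h2'.symm))
  · exact Or.inl (h1.trans h1'.symm)

theorem latticePt_injective : Function.Injective latticePt := by
  intro u v h
  have h1 := congrArg Complex.re h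
  have h2 := congrArg Complex.im h
  simp only [latticePt, Int.cast_inj] at h1 h2
  exact Prod.ext h1 h2

/-- The union of the edges in `E` is a union of Jordan curves, the integrals over which add up to
the integrals over the edges. -/
def HasJordanCurves (E : Finset GridEdge) : Prop :=
  ∃ (n : ℕ) (γ : Fin n → ℝ → ℂ), (∀ k, IsC1JordanCurve (γ k)) ∧
    ⋃ k, γ k '' Icc 0 1 = ⋃ e ∈ E, edgeSeg e ∧
    ∀ w ∉ ⋃ e ∈ E, edgeSeg e, ∑ k, ∫ t in (0 : ℝ)..1, deriv (γ k) t / (γ k t - w)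
      = ∑ e ∈ E, segIntegral (latticePt e.tail) (latticePt e.head) w

/-- Each simple cycle removed from `E` becomes a polygon. Two of its half-open edges can meet only
if they share their tail, which simplicity excludes for distinct indices, or are reverses of each
other, which is impossible for boundary edges of `S`. Different polygons may touch at vertices. -/
theorem hasJordanCurves {S : Finset (ℤ × ℤ)} {E : Finset GridEdge}
    (hE : IsBalanced GridEdge.tail GridEdge.head E) (hES : E ⊆ boundaryEdges S) :
    HasJordanCurves E := by
  revert hES
  refine IsBalanced.induction (p := fun E => E ⊆ boundaryEdges S → HasJordanCurves E) ?_ ?_ hE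
  · exact fun _ => ⟨0, Fin.elim0, fun k => k.elim0, by simp, by simp⟩
  · intro E m f hf hdisj ih hES
    obtain ⟨n, γ, h1, h2, h3⟩ := ih (Finset.union_subset_left hES)
    have hfS : ∀ k < m, f k ∈ boundaryEdges S := fun k hk =>
      hES (Finset.mem_union_right _ (Finset.mem_image_of_mem _ (Finset.mem_range.2 hk)))
    set p : ℕ → ℂ := fun k => latticePt (f k).tail with hp
    have hhead : ∀ k, p (k + 1) = latticePt (f k).head := fun k => by rw [hf.head_eq]
    have hseg : ∀ k, segment ℝ (p k) (p (k + 1)) = edgeSeg (f k) := fun k => by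
      rw [hhead, edgeSeg]
    refine ⟨n + 1, Fin.cons (polygon p m) γ, fun k => ?_, ?_, ?_⟩
    · refine Fin.cases ?_ (fun k => ?_) k
      · rw [Fin.cons_zero]
        refine isC1JordanCurve_polygon hf.pos (by simp [hp, hf.periodic]) ?_
        intro j hj k hk s hs t ht hst
        rw [hhead, hhead] at hst
        rcases tail_eq_or_eq_rev hs ht hst with h | h
        · obtain rfl := hf.injOn hj hk h
          refine ⟨rfl, ?_⟩
          rw [add_right_inj] at hst
          exact smul_left_injective ℝ
            (sub_ne_zero.2 (latticePt_injective.ne (GridEdge.head_ne_tail _))) hst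
        · have a := (mem_boundaryEdges.1 (hfS j hj)).2
          rw [← h] at a
          exact absurd (mem_boundaryEdges.1 (hfS k hk)).1 a
      · rw [Fin.cons_succ]
        exact h1 k
    · have : ⋃ k, (Fin.cons (polygon p m) γ : Fin (n + 1) → ℝ → ℂ) k '' Icc 0 1
          = polygon p m '' Icc 0 1 ∪ ⋃ k, γ k '' Icc 0 1 := by
        ext z
        simp [Fin.exists_fin_succ]
      rw [this, h2, image_polygon hf.pos, Finset.set_biUnion_union, Finset.set_biUnion_finset_image,
        union_comm]
      simp only [hseg]
    · intro w hw
      rw [Finset.set_biUnion_union, mem_union, not_or, Finset.set_biUnion_finset_image] at hw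
      rw [Fin.sum_univ_succ, Finset.sum_union hdisj, Finset.sum_image hf.injOn_edge, add_comm]
      simp only [Fin.cons_zero, Fin.cons_succ]
      rw [h3 w hw.1, integral_polygon hf.pos]
      · simp only [hf.head_eq, hp]
      · intro k hk h
        rw [hseg] at h
        exact hw.2 (mem_biUnion (Finset.mem_range.2 hk) h)

/-! ### The region bounded by grid edges -/

/-- The interior of the union of the squares in `S`: the points all of whose squares belong to
`S`. -/
def gridRegion (S : Finset (ℤ × ℤ)) : Set ℂ := {z | ∀ s, z ∈ closedSq s → s ∈ S}

theorem locallyFinite_sq : LocallyFinite closedSq := by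
  intro z
  refine ⟨Ioo (z.re - 1) (z.re + 1) ×ℂ Ioo (z.im - 1) (z.im + 1),
    (isOpen_Ioo.reProdIm isOpen_Ioo).mem_nhds ?_, ?_⟩
  · simp [Complex.mem_reProdIm]
  · refine ((Set.finite_Icc ⌊z.re - 2⌋ ⌈z.re + 1⌉).prod
      (Set.finite_Icc ⌊z.im - 2⌋ ⌈z.im + 1⌉)).subset ?_
    rintro s ⟨w, hw, ⟨h1, h2⟩, h3, h4⟩
    obtain ⟨⟨h1', h2'⟩, h3', h4'⟩ := mem_sq.1 hw
    exact ⟨⟨Int.floor_le_iff.2 (by linarith),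
      Int.cast_le.1 ((by linarith : (s.1 : ℝ) ≤ z.re + 1).trans
      (Int.le_ceil _))⟩, Int.floor_le_iff.2 (by linarith),
      Int.cast_le.1 ((by linarith : (s.2 : ℝ) ≤ z.im + 1).trans (Int.le_ceil _))⟩

/-- The complement is a locally finite union of closed squares. -/
theorem isOpen_gridRegion (S : Finset (ℤ × ℤ)) : IsOpen (gridRegion S) := by
  have : gridRegion S = (⋃ s : {s // s ∉ S}, closedSq s)ᶜ := by
    ext z
    simp only [gridRegion, mem_ofPred_eq, mem_compl_iff, mem_iUnion, Subtype.exists, not_exists]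
    exact forall_congr' fun s => ⟨fun h hs hz => hs (h hz), fun h hz => by_contra fun hs => h hs hz⟩
  rw [this, isOpen_compl_iff]
  exact (locallyFinite_sq.comp_injective Subtype.val_injective).isClosed_iUnion
    fun s => isClosed_sq s

theorem openSq_subset_gridRegion {S : Finset (ℤ × ℤ)} {s : ℤ × ℤ} (hs : s ∈ S) :
    openSq s ⊆ gridRegion S := fun _ hz _ hz' => eq_of_mem_openSq_of_mem_sq hz hz' ▸ hs

theorem closure_gridRegion (S : Finset (ℤ × ℤ)) : closure (gridRegion S) = ⋃ s ∈ S, closedSq s := by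
  refine Subset.antisymm (closure_minimal ?_ (isClosed_biUnion_finset fun s _ => isClosed_sq s)) ?_
  · intro z hz
    obtain ⟨s, hs⟩ := exists_mem_sq z
    exact mem_biUnion (hz s hs) hs
  · refine iUnion₂_subset fun s hs => ?_
    rw [← closure_openSq]
    exact closure_mono (openSq_subset_gridRegion hs)

/-- The two squares may touch only at a corner. The square `(m', n)` also contains `z` and either
equals or shares a side with each of them, so `S` is left across one of these sides. -/
theorem exists_boundaryEdge {S : Finset (ℤ × ℤ)} {s s' : ℤ × ℤ} {z : ℂ} (hz : z ∈ closedSq s)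
    (hz' : z ∈ closedSq s') (hs : s ∈ S) (hs' : s' ∉ S) : ∃ e ∈ boundaryEdges S, z ∈ edgeSeg e := by
  suffices H : ∃ e : GridEdge, e.1 ∈ S ∧ e.rev.1 ∉ S ∧ z ∈ closedSq e.1 ∧ z ∈ closedSq e.rev.1 by
    obtain ⟨e, h1, h2, h3, h4⟩ := H
    exact ⟨e, mem_boundaryEdges.2 ⟨h1, h2⟩, mem_edgeSeg.2 ⟨h3, h4⟩⟩
  obtain ⟨m, n⟩ := s
  obtain ⟨m', n'⟩ := s'
  obtain ⟨⟨h1, h2⟩, h3, h4⟩ := mem_sq.1 hz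
  obtain ⟨⟨h1', h2'⟩, h3', h4'⟩ := mem_sq.1 hz'
  simp only at h1 h2 h3 h4 h1' h2' h3' h4'
  have a1 : m ≤ m' + 1 := by exact_mod_cast h1.trans h2'
  have a2 : m' ≤ m + 1 := by exact_mod_cast h1'.trans h2
  have a3 : n ≤ n' + 1 := by exact_mod_cast h3.trans h4'
  have a4 : n' ≤ n + 1 := by exact_mod_cast h3'.trans h4
  have hmid : z ∈ closedSq (m', n) := mem_sq.2 ⟨⟨h1', h2'⟩, h3, h4⟩
  by_cases hm : (m', n) ∈ S
  · have hn : n' ≠ n := by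
      rintro rfl
      exact hs' hm
    rcases (by omega : n' = n + 1 ∨ n' = n + -1) with rfl | rfl
    · exact ⟨((m', n), 2), by simpa [GridEdge.rev, neighbour] using ⟨hm, hs', hmid, hz'⟩⟩
    · exact ⟨((m', n), 0), by simpa [GridEdge.rev, neighbour] using ⟨hm, hs', hmid, hz'⟩⟩
  · have hn : m' ≠ m := by
      rintro rfl
      exact hm hs
    rcases (by omega : m' = m + 1 ∨ m' = m + -1) with rfl | rfl
    · exact ⟨((m, n), 1), by simpa [GridEdge.rev, neighbour] using ⟨hs, hm, hz, hmid⟩⟩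
    · exact ⟨((m, n), 3), by simpa [GridEdge.rev, neighbour] using ⟨hs, hm, hz, hmid⟩⟩

theorem frontier_gridRegion (S : Finset (ℤ × ℤ)) :
    frontier (gridRegion S) = ⋃ e ∈ boundaryEdges S, edgeSeg e := by
  rw [(isOpen_gridRegion S).frontier_eq, closure_gridRegion]
  ext z
  constructor
  · rintro ⟨hz, hzD⟩
    obtain ⟨s, hs, hz⟩ := mem_iUnion₂.1 hz
    obtain ⟨s', hz', hs'⟩ : ∃ s', z ∈ closedSq s' ∧ s' ∉ S := by
      simpa [gridRegion] using hzD
    obtain ⟨e, he, h⟩ := exists_boundaryEdge hz hz' hs hs'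
    exact mem_biUnion he h
  · intro hz
    obtain ⟨e, he, hz⟩ := mem_iUnion₂.1 hz
    obtain ⟨h1, h2⟩ := mem_boundaryEdges.1 he
    obtain ⟨h3, h4⟩ := mem_edgeSeg.1 hz
    exact ⟨mem_biUnion h1 h3, fun h => h2 (h _ h4)⟩

/-! ### Winding numbers of squares -/

/-- The factor `c` rotates the segment, seen from `w`, away from the branch cut, so the principal
logarithm supplies a primitive. -/
theorem segIntegral_eq_log {a b w c : ℂ} (hc : c ≠ 0)
    (h : ∀ z ∈ segment ℝ a b, c * (z - w) ∈ Complex.slitPlane) :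
    segIntegral a b w = Complex.log (c * (b - w)) - Complex.log (c * (a - w)) := by
  have hmem : ∀ s ∈ uIcc (0 : ℝ) 1, c * (a + s • (b - a) - w) ∈ Complex.slitPlane := by
    intro s hs
    rw [uIcc_of_le zero_le_one] at hs
    refine h _ ?_
    rw [segment_eq_image']
    exact ⟨s, hs, rfl⟩
  have hd : ∀ s ∈ uIcc (0 : ℝ) 1, HasDerivAt (fun s : ℝ => Complex.log (c * (a + s • (b - a) - w)))
      ((b - a) / (a + s • (b - a) - w)) s := by
    intro s hs
    have h1 : HasDerivAt (fun s : ℝ => c * (a + s • (b - a) - w)) (c * (b - a)) s := by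
      have := ((((hasDerivAt_id s).smul_const (b - a)).const_add a).sub_const w).const_mul c
      simpa using this
    have h2 := h1.clog_real (hmem s hs)
    rwa [mul_div_mul_left _ _ hc] at h2
  rw [segIntegral, intervalIntegral.integral_eq_sub_of_hasDerivAt hd]
  · simp
  · refine ContinuousOn.intervalIntegrable (ContinuousOn.div continuousOn_const (by fun_prop) ?_)
    intro s hs h0
    have := hmem s hs
    rw [h0, mul_zero] at this
    exact Complex.slitPlane_ne_zero this rfl

theorem edgeSeg_subset_sq (s : ℤ × ℤ) (i : Fin 4) : edgeSeg (s, i) ⊆ closedSq s :=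
  fun _ hz => (mem_edgeSeg.1 hz).1

/-- A horizontal or vertical line separates `w` from the square, so one branch of the logarithm
serves all four sides and the sum telescopes. -/
theorem sum_segIntegral_of_notMem_sq {s : ℤ × ℤ} {w : ℂ} (hw : w ∉ closedSq s) :
    ∑ i, segIntegral (latticePt (GridEdge.tail (s, i))) (latticePt (GridEdge.head (s, i))) w
      = 0 := by
  obtain ⟨c, hc, h⟩ : ∃ c : ℂ, c ≠ 0 ∧ ∀ z ∈ closedSq s, c * (z - w) ∈ Complex.slitPlane := by
    simp only [mem_sq, not_and_or, not_le] at hw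
    rcases hw with (hw | hw) | hw | hw
    · exact ⟨1, one_ne_zero, fun z hz => Or.inl (by simp; linarith [(mem_sq.1 hz).1.1])⟩
    · exact ⟨-1, by simp, fun z hz => Or.inl (by simp; linarith [(mem_sq.1 hz).1.2])⟩
    · exact ⟨-Complex.I, by simp, fun z hz => Or.inl (by simp; linarith [(mem_sq.1 hz).2.1])⟩
    · exact ⟨Complex.I, by simp, fun z hz => Or.inl (by simp; linarith [(mem_sq.1 hz).2.2])⟩
  have h' : ∀ i, segIntegral (latticePt (GridEdge.tail (s, i))) (latticePt (GridEdge.head (s, i))) w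
      = Complex.log (c * (latticePt (s + corner (i + 1)) - w))
        - Complex.log (c * (latticePt (s + corner i) - w)) := fun i =>
    segIntegral_eq_log hc fun z hz => h z (edgeSeg_subset_sq s i hz)
  rw [Finset.sum_congr rfl fun i _ => h' i, Finset.sum_sub_distrib, sub_eq_zero]
  exact Fintype.sum_equiv (Equiv.addRight 1) _ _ fun i => rfl

/-- Turning the first quadrant by `-π/2` does not cross the branch cut. -/
theorem log_sub_log_neg_I_mul {u : ℂ} (hre : 0 < u.re) (him : 0 < u.im) :
    Complex.log u - Complex.log (-Complex.I * u) = Real.pi / 2 * Complex.I := by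
  have hu : u ≠ 0 := fun h => by simp [h] at hre
  have h1 : 0 ≤ u.arg := Complex.arg_nonneg_iff.2 him.le
  have h2 : u.arg ≤ Real.pi := Complex.arg_le_pi u
  rw [(Complex.log_mul_eq_add_log_iff (by simp) hu).2, Complex.log_neg_I]
  · ring
  · rw [Complex.arg_neg_I]
    constructor <;> linarith [Real.pi_pos]

/-- Every side needs its own branch, `c = I, 1, -I, -1` in turn. At each corner consecutive branches
differ by `πi/2`, and the four jumps add up to `2πi`. -/
theorem sum_segIntegral_of_mem_openSq {s : ℤ × ℤ} {w : ℂ} (hw : w ∈ openSq s) :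
    ∑ i, segIntegral (latticePt (GridEdge.tail (s, i))) (latticePt (GridEdge.head (s, i))) w
      = 2 * Real.pi * Complex.I := by
  obtain ⟨⟨h1, h2⟩, h3, h4⟩ := mem_openSq.1 hw
  set v : Fin 4 → ℂ := fun i => latticePt (s + corner i) - w with hv
  have hside : ∀ (i : Fin 4) (c : ℂ), c ≠ 0 →
      (∀ z ∈ edgeSeg (s, i), c * (z - w) ∈ Complex.slitPlane) →
      segIntegral (latticePt (GridEdge.tail (s, i))) (latticePt (GridEdge.head (s, i))) w
        = Complex.log (c * v (i + 1)) - Complex.log (c * v i) := fun i c hc h =>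
    segIntegral_eq_log hc h
  have e0 := hside 0 Complex.I (by simp) fun z hz => Or.inl (by
    have := (mem_sq.1 (mem_edgeSeg.1 hz).2).2.2
    simp [GridEdge.rev, neighbour] at this ⊢
    linarith)
  have e1 := hside 1 1 (by simp) fun z hz => Or.inl (by
    have := (mem_sq.1 (mem_edgeSeg.1 hz).2).1.1
    simp [GridEdge.rev, neighbour] at this ⊢
    linarith)
  have e2 := hside 2 (-Complex.I) (by simp) fun z hz => Or.inl (by
    have := (mem_sq.1 (mem_edgeSeg.1 hz).2).2.1
    simp [GridEdge.rev, neighbour] at this ⊢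
    linarith)
  have e3 := hside 3 (-1) (by simp) fun z hz => Or.inl (by
    have := (mem_sq.1 (mem_edgeSeg.1 hz).2).1.2
    simp [GridEdge.rev, neighbour] at this ⊢
    linarith)
  have c0 := log_sub_log_neg_I_mul (u := -1 * v 0)
    (by simp [hv, latticePt, corner]; linarith) (by simp [hv, latticePt, corner]; linarith)
  have c1 := log_sub_log_neg_I_mul (u := Complex.I * v 1)
    (by simp [hv, latticePt, corner]; linarith) (by simp [hv, latticePt, corner]; linarith)
  have c2 := log_sub_log_neg_I_mul (u := 1 * v 2)
    (by simp [hv, latticePt, corner]; linarith) (by simp [hv, latticePt, corner]; linarith)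
  have c3 := log_sub_log_neg_I_mul (u := -Complex.I * v 3)
    (by simp [hv, latticePt, corner]; linarith) (by simp [hv, latticePt, corner]; linarith)
  rw [show -Complex.I * (-1 * v 0) = Complex.I * v 0 by ring] at c0
  rw [show -Complex.I * (Complex.I * v 1) = 1 * v 1 by
    linear_combination -v 1 * Complex.I_mul_I] at c1
  rw [show -Complex.I * (1 * v 2) = -Complex.I * v 2 by ring] at c2
  rw [show -Complex.I * (-Complex.I * v 3) = -1 * v 3 by
    linear_combination v 3 * Complex.I_mul_I] at c3
  rw [Fin.sum_univ_four, e0, e1, e2, e3]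
  simp only [show (0 : Fin 4) + 1 = 1 from rfl, show (1 : Fin 4) + 1 = 2 from rfl,
    show (2 : Fin 4) + 1 = 3 from rfl, show (3 : Fin 4) + 1 = 0 from rfl]
  linear_combination c0 + c1 + c2 + c3

theorem continuousAt_segIntegral {a b w : ℂ} (hw : w ∉ segment ℝ a b) :
    ContinuousAt (segIntegral a b) w := by
  have h := differentiableAt_cauchyIntegral (γ := fun s : ℝ => a + s • (b - a))
    (φ := fun _ => b - a) (w := w) (by fun_prop) (continuousOn_const.intervalIntegrable)
    (by rwa [segment_eq_image'] at hw)
  refine h.continuousAt.congr (Filter.Eventually.of_forall fun z => ?_)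
  simp only [segIntegral, smul_eq_mul, div_eq_inv_mul]

/-- The integral over the boundary is the sum of the integrals around the squares of `S`. It is
`2πi` in the open squares of `S` and `0` off the closure; on inner edges and vertices the value
follows by continuity from an adjacent open square. -/
theorem exists_isPositiveBoundary_gridRegion (S : Finset (ℤ × ℤ)) :
    ∃ (n : ℕ) (γ : Fin n → ℝ → ℂ), IsPositiveBoundary (gridRegion S) γ := by
  obtain ⟨n, γ, h1, h2, h3⟩ := hasJordanCurves (isBalanced_boundaryEdges S) Subset.rfl
  set W : ℂ → ℂ := fun w =>
    ∑ e ∈ boundaryEdges S, segIntegral (latticePt e.tail) (latticePt e.head) w with hW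
  have hsum : ∀ w, W w = ∑ s ∈ S, ∑ i, segIntegral (latticePt (GridEdge.tail (s, i)))
      (latticePt (GridEdge.head (s, i))) w := fun w =>
    sum_boundaryEdges S (fun e => segIntegral (latticePt e.tail) (latticePt e.head) w) fun e => by
      rw [e.tail_rev, e.head_rev, segIntegral_symm]
  rw [← frontier_gridRegion] at h2 h3
  refine ⟨n, γ, h1, h2, fun w hw => ?_, fun w hw => ?_⟩
  · have hfr : ∀ w ∈ gridRegion S, w ∉ frontier (gridRegion S) := fun w hw h => by
      rw [(isOpen_gridRegion S).frontier_eq] at h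
      exact h.2 hw
    rw [windingNumber, h3 w (hfr w hw)]
    change _ * W w = 1
    obtain ⟨s, hs⟩ := exists_mem_sq w
    have hsS := hw s hs
    have hWs : ∀ z ∈ openSq s, W z = 2 * Real.pi * Complex.I := fun z hz => by
      rw [hsum, Finset.sum_eq_single_of_mem s hsS, sum_segIntegral_of_mem_openSq hz]
      intro s' _ hne
      exact sum_segIntegral_of_notMem_sq fun h => hne (eq_of_mem_openSq_of_mem_sq hz h).symm
    have hcont : ContinuousAt W w := by
      refine tendsto_finsetSum _ fun e he => continuousAt_segIntegral fun h => hfr w hw ?_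
      rw [frontier_gridRegion]
      exact mem_biUnion he h
    rw [← closure_openSq, mem_closure_iff_nhdsWithin_neBot] at hs
    have hlim : Filter.Tendsto W (nhdsWithin w (openSq s)) (nhds (2 * Real.pi * Complex.I)) :=
      tendsto_const_nhds.congr' (by
        filter_upwards [self_mem_nhdsWithin] with z hz using (hWs z hz).symm)
    rw [tendsto_nhds_unique (hcont.mono_left nhdsWithin_le_nhds) hlim,
      inv_mul_cancel₀ Complex.two_pi_I_ne_zero]
  · rw [windingNumber, h3 w fun h => hw (frontier_subset_closure h)]
    change _ * W w = 0
    rw [closure_gridRegion] at hw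
    rw [hsum, Finset.sum_eq_zero, mul_zero]
    exact fun s hs => sum_segIntegral_of_notMem_sq fun h => hw (mem_biUnion hs h)

/-! ### Separating regions with piecewise smooth boundary -/

/-- Scaling passes from the unit grid to arbitrarily fine grids. -/
theorem IsPositiveBoundary.smul {D : Set ℂ} {n : ℕ} {γ : Fin n → ℝ → ℂ}
    (h : IsPositiveBoundary D γ) {c : ℝ} (hc : c ≠ 0) :
    IsPositiveBoundary ((fun z : ℂ => c⁻¹ • z) ⁻¹' D) fun k t => c • γ k t := by
  let φ : ℂ ≃ₜ ℂ := Homeomorph.smulOfNeZero c⁻¹ (inv_ne_zero hc)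
  have hφ : (fun z : ℂ => c⁻¹ • z) = φ := rfl
  have hφs : ∀ z : ℂ, φ.symm z = c • z := fun z => by
    rw [Homeomorph.symm_apply_eq]
    change z = c⁻¹ • c • z
    rw [inv_smul_smul₀ hc]
  have hcC : (c : ℂ) ≠ 0 := by exact_mod_cast hc
  have hwind : ∀ w, windingNumber (fun k t => c • γ k t) w = windingNumber γ (φ w) := by
    intro w
    simp only [windingNumber]
    congr 1
    refine Finset.sum_congr rfl fun k _ => intervalIntegral.integral_congr fun t _ => ?_
    have hd : deriv (fun t => c • γ k t) t = c • deriv (γ k) t := deriv_const_smul_field c (γ k)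
    have hw : w = c • φ w := by rw [← hφs, φ.symm_apply_apply]
    simp only [hd]
    conv_lhs => rw [hw]
    rw [← smul_sub, Complex.real_smul, Complex.real_smul, mul_div_mul_left _ _ hcC]
  rw [hφ]
  refine ⟨fun k => ⟨?_, ?_, ?_⟩, ?_, fun w hw => ?_, fun w hw => ?_⟩
  · exact (h.isC1JordanCurve k).contDiffOn.const_smul c
  · simp only [(h.isC1JordanCurve k).closed]
  · exact fun s hs t ht hst => (h.isC1JordanCurve k).injOn hs ht (smul_right_injective ℂ hc hst)
  · rw [← φ.preimage_frontier, ← h.iUnion_image, preimage_iUnion]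
    refine iUnion_congr fun k => ?_
    rw [← φ.image_symm, image_image]
    simp only [hφs]
  · rw [hwind, h.winding_inside _ hw]
  · rw [hwind, h.winding_outside]
    rwa [← φ.preimage_closure] at hw

/-- Reflection exchanges the lower and the upper side, whence the row `-s.2 - 1`. -/
theorem conj_mem_sq {s : ℤ × ℤ} {z : ℂ} (hz : z ∈ closedSq s) :
    starRingEnd ℂ z ∈ closedSq (s.1, -s.2 - 1) := by
  obtain ⟨⟨h1, h2⟩, h3, h4⟩ := mem_sq.1 hz
  refine mem_sq.2 ⟨⟨by simpa using h1, by simpa using h2⟩, ?_, ?_⟩ <;> push_cast <;>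
    rw [Complex.conj_im] <;> linarith

theorem norm_sub_le_of_mem_sq {s : ℤ × ℤ} {z w : ℂ} (hz : z ∈ closedSq s) (hw : w ∈ closedSq s) :
    ‖z - w‖ ≤ 2 := by
  obtain ⟨⟨h1, h2⟩, h3, h4⟩ := mem_sq.1 hz
  obtain ⟨⟨h1', h2'⟩, h3', h4'⟩ := mem_sq.1 hw
  refine (Complex.norm_le_abs_re_add_abs_im _).trans ?_
  have a1 : |(z - w).re| ≤ 1 := by
    rw [Complex.sub_re, abs_le]
    constructor <;> linarith
  have a2 : |(z - w).im| ≤ 1 := by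
    rw [Complex.sub_im, abs_le]
    constructor <;> linarith
  linarith

theorem isBounded_gridRegion (S : Finset (ℤ × ℤ)) : Bornology.IsBounded (gridRegion S) := by
  refine Bornology.IsBounded.subset ?_ subset_closure
  rw [closure_gridRegion]
  refine (Bornology.isBounded_biUnion_finset S).2 fun s _ => ?_
  exact (Metric.isBounded_Icc _ _).reProdIm (Metric.isBounded_Icc _ _)

/-- `S` consists of all squares that meet `K`; it is symmetric because the grid and `K` are. -/
theorem exists_gridRegion {K : Set ℂ} (hK : IsCompact K) (hconj : ∀ z ∈ K, starRingEnd ℂ z ∈ K) :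
    ∃ S : Finset (ℤ × ℤ), K ⊆ gridRegion S ∧
      (∀ z ∈ gridRegion S, starRingEnd ℂ z ∈ gridRegion S) ∧
      ∀ z ∈ closure (gridRegion S), ∃ w ∈ K, ‖z - w‖ ≤ 2 := by
  have hfin := locallyFinite_sq.finite_nonempty_inter_compact hK
  refine ⟨hfin.toFinset, fun z hz s hs => ?_, fun z hz s hs => ?_, fun z hz => ?_⟩
  · rw [Finite.mem_toFinset]
    exact ⟨z, hs, hz⟩
  · have h := conj_mem_sq hs
    rw [Complex.conj_conj] at h
    obtain ⟨w, hw, hwK⟩ := (Finite.mem_toFinset hfin).1 (hz _ h)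
    rw [Finite.mem_toFinset]
    refine ⟨_, ?_, hconj w hwK⟩
    simpa using conj_mem_sq hw
  · rw [closure_gridRegion] at hz
    obtain ⟨s, hs, hzs⟩ := mem_iUnion₂.1 hz
    obtain ⟨w, hw, hwK⟩ := (Finite.mem_toFinset hfin).1 hs
    exact ⟨w, hwK, norm_sub_le_of_mem_sq hzs hw⟩

open scoped Pointwise in
/-- A compact set which is symmetric about the real axis has arbitrarily small symmetric
neighbourhoods which are bounded by Jordan curves. -/
theorem exists_symmetric_neighbourhood {K : Set ℂ} (hK : IsCompact K)
    (hconj : ∀ z ∈ K, starRingEnd ℂ z ∈ K) {ε : ℝ} (hε : 0 < ε) :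
    ∃ D : Set ℂ, IsOpen D ∧ Bornology.IsBounded D ∧ K ⊆ D ∧
      (∀ z ∈ D, starRingEnd ℂ z ∈ D) ∧ (∀ z ∈ closure D, ∃ w ∈ K, ‖z - w‖ ≤ ε) ∧
      ∃ (n : ℕ) (γ : Fin n → ℝ → ℂ), IsPositiveBoundary D γ := by
  -- Points of `closure (gridRegion S)` are within `2` of the rescaled `K`, so mesh `ε / 2` gives
  -- distance `ε`.
  set c : ℝ := ε / 2 with hc
  have hc0 : c ≠ 0 := by positivity
  let φ : ℂ ≃ₜ ℂ := Homeomorph.smulOfNeZero c⁻¹ (inv_ne_zero hc0)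
  have hφ : ∀ z, φ z = c⁻¹ • z := fun z => rfl
  have hconj' : ∀ z, φ (starRingEnd ℂ z) = starRingEnd ℂ (φ z) := fun z => by
    simp [hφ]
  obtain ⟨S, h1, h2, h3⟩ := exists_gridRegion (K := φ '' K) (hK.image φ.continuous) (by
    rintro _ ⟨z, hz, rfl⟩
    exact ⟨_, hconj z hz, hconj' z⟩)
  obtain ⟨n, γ, hγ⟩ := exists_isPositiveBoundary_gridRegion S
  refine ⟨φ ⁻¹' gridRegion S, (isOpen_gridRegion S).preimage φ.continuous, ?_,
    fun z hz => h1 (mem_image_of_mem _ hz), fun z hz => ?_, fun z hz => ?_, n, _, hγ.smul hc0⟩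
  · have : φ ⁻¹' gridRegion S = c • gridRegion S := by
      ext z
      rw [mem_smul_set_iff_inv_smul_mem₀ hc0]
      rfl
    rw [this]
    exact (isBounded_gridRegion S).smul₀ c
  · rw [mem_preimage, hconj']
    exact h2 _ hz
  · rw [← φ.preimage_closure] at hz
    obtain ⟨_, ⟨w, hw, rfl⟩, hzw⟩ := h3 _ hz
    refine ⟨w, hw, ?_⟩
    rw [hφ, hφ, ← smul_sub, norm_smul, norm_inv, Real.norm_of_nonneg (by positivity : 0 ≤ c)] at hzw
    rw [inv_mul_le_iff₀ (by positivity)] at hzw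
    linarith

/-! ### Slices -/

theorem re_sliceEmb {I : ℍ} (hI : I ∈ imagUnits) (z : ℂ) : (sliceEmb I z).re = z.re := by
  simp [sliceEmb, hI.1]

theorem im_sliceEmb {I : ℍ} (hI : I ∈ imagUnits) (z : ℂ) :
    (sliceEmb I z).im = I * (z.im : ℍ) := by
  ext <;> simp [sliceEmb, hI.1]

theorem norm_im_sliceEmb {I : ℍ} (hI : I ∈ imagUnits) (z : ℂ) :
    ‖(sliceEmb I z).im‖ = |z.im| := by
  rw [im_sliceEmb hI, norm_mul, hI.2, one_mul, Quaternion.norm_coe, Real.norm_eq_abs]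

/-- The point `Re q + i |Im q|`. -/
def upperPt (q : ℍ) : ℂ := ⟨q.re, ‖q.im‖⟩

theorem continuous_upperPt : Continuous upperPt := by
  have h : upperPt = fun q => (q.re : ℂ) + (‖q.im‖ : ℂ) * Complex.I := by
    ext q
    exact Complex.mk_eq_add_mul_I _ _
  rw [h]
  have h1 := Quaternion.continuous_re
  have h2 := Quaternion.continuous_im
  fun_prop

theorem upperPt_sliceEmb {I : ℍ} (hI : I ∈ imagUnits) (z : ℂ) :
    upperPt (sliceEmb I z) = ⟨z.re, |z.im|⟩ := by
  rw [upperPt, re_sliceEmb hI, norm_im_sliceEmb hI]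

theorem norm_sq_eq (q : ℍ) : ‖q‖ ^ 2 = q.re ^ 2 + ‖q.im‖ ^ 2 := by
  have h1 := Quaternion.normSq_eq_norm_mul_self q
  have h2 := Quaternion.normSq_eq_norm_mul_self q.im
  rw [Quaternion.normSq_def'] at h1 h2
  simp at h2
  nlinarith

theorem norm_upperPt (q : ℍ) : ‖upperPt q‖ = ‖q‖ := by
  rw [← sq_eq_sq₀ (norm_nonneg _) (norm_nonneg _), norm_sq_eq, Complex.sq_norm,
    Complex.normSq_apply,
    upperPt]
  ring

theorem upperPt_of_mem_sphere {q p : ℍ} (hp : p ∈ sphere q) : upperPt p = upperPt q := by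
  obtain ⟨I, hI, rfl⟩ := hp
  have := upperPt_sliceEmb hI (upperPt q)
  simpa [sliceEmb, upperPt] using this

theorem isAxiallySymmetric_preimage_upperPt (D : Set ℂ) : IsAxiallySymmetric (upperPt ⁻¹' D) :=
  fun q hq p hp => by
    rw [mem_preimage, upperPt_of_mem_sphere hp]
    exact hq

/-- All slices of the rotated set are the same `D`, so one family of curves serves every `I`. -/
theorem slice_preimage_upperPt {I : ℍ} (hI : I ∈ imagUnits) {D : Set ℂ}
    (hD : ∀ z ∈ D, starRingEnd ℂ z ∈ D) : slice I (upperPt ⁻¹' D) = D := by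
  ext z
  rw [slice, mem_preimage, mem_preimage, upperPt_sliceEmb hI]
  rcases le_total 0 z.im with h | h
  · rw [abs_of_nonneg h]
  · rw [abs_of_nonpos h, show (⟨z.re, -z.im⟩ : ℂ) = starRingEnd ℂ z from rfl]
    exact ⟨fun h => by simpa using hD _ h, hD z⟩

/-! ### The complex Banach space underlying a right quaternionic one -/

/-- The space `W` with its structure of a complex vector space by right multiplication. -/
def Cx (W : Type*) := W

/-- The inclusion of `ℂ` into the opposite of `ℍ`. -/
def complexToOp : ℂ →+* ℍᵐᵒᵖ where
  toFun z := op (z : ℍ)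
  map_one' := rfl
  map_zero' := rfl
  map_add' z w := by rw [Quaternion.coeComplex_add, op_add]
  -- Commutativity of `ℂ` absorbs the reversal of products in `ℍᵐᵒᵖ`.
  map_mul' z w := by rw [mul_comm z w, Quaternion.coeComplex_mul, op_mul]

theorem norm_coeComplex (z : ℂ) : ‖(z : ℍ)‖ = ‖z‖ := by
  rw [← sq_eq_sq₀ (norm_nonneg _) (norm_nonneg _), Complex.sq_norm, Complex.normSq_apply, sq,
    ← Quaternion.normSq_eq_norm_mul_self, Quaternion.normSq_def']
  simp
  ring

section Complexification

variable {W : Type*} [NormedAddCommGroup W] [Module ℍᵐᵒᵖ W]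

instance : NormedAddCommGroup (Cx W) := inferInstanceAs (NormedAddCommGroup W)

instance : Module ℂ (Cx W) := Module.compHom W complexToOp

theorem Cx.smul_def (z : ℂ) (f : Cx W) : z • f = (op (z : ℍ) • (show W from f) : W) := rfl

/-- A right linear operator as a complex linear one. -/
def toCx : (W →L[ℍᵐᵒᵖ] W) →+* (Cx W →L[ℂ] Cx W) where
  toFun T :=
    { toFun := T
      map_add' := T.map_add
      map_smul' := fun z f => T.map_smul (op (z : ℍ)) f
      cont := T.cont }
  map_one' := rfl
  map_zero' := rfl
  map_add' _ _ := rfl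
  map_mul' _ _ := rfl

/-- The inverse of a right `ℍ`-linear bijection is right `ℍ`-linear, so invertibility may be tested
over `ℂ`. -/
theorem isUnit_toCx {S : W →L[ℍᵐᵒᵖ] W} : IsUnit (toCx S) ↔ IsUnit S := by
  refine ⟨fun h => ?_, fun h => h.map toCx⟩
  obtain ⟨B, hB1, hB2⟩ := isUnit_iff_exists.1 h
  have h1 : ∀ f : W, S (B f) = f := fun f => DFunLike.congr_fun hB1 f
  have h2 : ∀ f : W, (B (S f) : Cx W) = f := fun f => DFunLike.congr_fun hB2 f
  have hadd : ∀ f g : W, (B (f + g : W) : W) = (B f : W) + (B g : W) := fun f g => B.map_add f g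
  have hsmul : ∀ (q : ℍᵐᵒᵖ) (f : W), (B (q • f : W) : W) = q • (show W from B f) := fun q f => by
    have h3 := h2 (q • (show W from B f))
    rw [S.map_smul] at h3
    exact (congrArg (fun g : W => (B (q • g : W) : W)) (h1 f).symm).trans h3
  let B' : W →L[ℍᵐᵒᵖ] W :=
    { toFun := fun f => B f
      map_add' := hadd
      map_smul' := hsmul
      cont := B.cont }
  refine isUnit_iff_exists.2 ⟨B', ?_, ?_⟩
  · ext f
    exact h1 f
  · ext f
    exact h2 f

variable [NormedSpace ℝ W] [IsScalarTower ℝ ℍᵐᵒᵖ W]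

theorem real_smul_eq (r : ℝ) (f : W) : r • f = op (r : ℍ) • f := by
  rw [← one_smul ℍᵐᵒᵖ f, ← smul_assoc, smul_smul, mul_one]
  congr 1
  rw [← op_one, ← op_smul]
  congr 1
  ext <;> simp

theorem Cx.ofReal_smul (r : ℝ) (f : Cx W) : (r : ℂ) • f = (r • (show W from f) : W) := by
  rw [Cx.smul_def, Quaternion.coeComplex_coe, real_smul_eq]

theorem mem_sResolventSet_congr (T : W →L[ℍᵐᵒᵖ] W) {q p : ℍ} (hre : q.re = p.re)
    (hn : ‖q‖ = ‖p‖) : q ∈ sResolventSet T ↔ p ∈ sResolventSet T := by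
  rw [sResolventSet, mem_ofPred_eq, mem_ofPred_eq, qOp, qOp, hre, hn]

variable [NormSMulClass ℍᵐᵒᵖ W]

instance : NormedSpace ℂ (Cx W) where
  norm_smul_le z f := by
    rw [Cx.smul_def]
    refine (norm_smul (op (z : ℍ)) (show W from f)).le.trans_eq ?_
    rw [MulOpposite.norm_op, norm_coeComplex]
    rfl

instance [CompleteSpace W] : CompleteSpace (Cx W) := inferInstanceAs (CompleteSpace W)

/-- The identity from `Cx W` to `W`. -/
def Cx.equiv : Cx W ≃ₗᵢ[ℝ] W where
  toFun f := f
  invFun f := f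
  left_inv _ := rfl
  right_inv _ := rfl
  map_add' _ _ := rfl
  map_smul' r f := Cx.ofReal_smul r f
  norm_map' _ := rfl

/-- The two integrals use different real structures, one restricted from `ℂ` and one given on `W`;
the identity is a real linear isometry between them. -/
theorem Cx.integral_eq (f : ℝ → Cx W) :
    (∫ t in (0 : ℝ)..1, (f t : Cx W)) = (∫ t in (0 : ℝ)..1, (show W from f t) : W) := by
  have h := fun s => (Cx.equiv (W := W)).toContinuousLinearEquiv.integral_comp_comm
    (μ := MeasureTheory.volume.restrict s) f
  simp only [intervalIntegral]
  have h1 := h (Ioc 0 1)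
  have h2 := h (Ioc 1 0)
  exact (congrArg₂ (· - ·) h1 h2).symm

theorem toCx_qOp (T : W →L[ℍᵐᵒᵖ] W) (q : ℍ) :
    toCx (qOp T q) = toCx T ^ 2 - ((2 * q.re : ℝ) : ℂ) • toCx T + ((‖q‖ ^ 2 : ℝ) : ℂ) • 1 := by
  have h : ∀ (r : ℝ) (A : W →L[ℍᵐᵒᵖ] W), toCx (r • A) = (r : ℂ) • toCx A := fun r A => by
    ext f
    exact (Cx.ofReal_smul r (A f)).symm
  rw [qOp, map_add, map_sub, map_pow, h, h, map_one]

/-- The polynomial `X² - 2 Re(z) X + |z|²` has the roots `z` and `z̄`. -/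
theorem toCx_qOp_eq_mul (T : W →L[ℍᵐᵒᵖ] W) {q : ℍ} {z : ℂ} (hre : q.re = z.re) (hn : ‖q‖ = ‖z‖) :
    toCx (qOp T q) = (algebraMap ℂ _ z - toCx T) * (algebraMap ℂ _ (starRingEnd ℂ z) - toCx T) := by
  rw [toCx_qOp, hre, hn, ← Complex.add_conj, Complex.sq_norm, ← Complex.mul_conj]
  simp only [Algebra.algebraMap_eq_smul_one, sub_mul, mul_sub, smul_mul_assoc, mul_smul_comm,
    one_mul, mul_one, add_smul, smul_sub, smul_smul, sq,
    mul_comm (starRingEnd ℂ z)]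
  abel

/-- A product of commuting operators is invertible exactly when both factors are. -/
theorem mem_sResolventSet_iff (T : W →L[ℍᵐᵒᵖ] W) {q : ℍ} {z : ℂ} (hre : q.re = z.re)
    (hn : ‖q‖ = ‖z‖) : q ∈ sResolventSet T ↔
      z ∈ resolventSet ℂ (toCx T) ∧ starRingEnd ℂ z ∈ resolventSet ℂ (toCx T) := by
  rw [sResolventSet, mem_ofPred_eq, ← isUnit_toCx, toCx_qOp_eq_mul T hre hn,
    Commute.isUnit_mul_iff]
  · rfl
  · have h : ∀ a b : ℂ, Commute (algebraMap ℂ (Cx W →L[ℂ] Cx W) a) (algebraMap ℂ _ b) :=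
      fun a b => Algebra.commutes a _
    have h' : ∀ a : ℂ, Commute (algebraMap ℂ (Cx W →L[ℂ] Cx W) a) (toCx T) :=
      fun a => Algebra.commutes a _
    exact ((h _ _).sub_right (h' _)).sub_left ((h' _).symm.sub_right (Commute.refl _))

theorem norm_sliceEmb {I : ℍ} (hI : I ∈ imagUnits) (z : ℂ) : ‖sliceEmb I z‖ = ‖z‖ := by
  rw [← sq_eq_sq₀ (norm_nonneg _) (norm_nonneg _), norm_sq_eq, re_sliceEmb hI, norm_im_sliceEmb hI,
    sq_abs, Complex.sq_norm, Complex.normSq_apply]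
  ring

/-- For `z` in the slice of the `S`-resolvent set, the resolvent of the underlying complex operator
is `Q_z(T)⁻¹ (z̄ - T)`. -/
theorem resolvent_toCx_apply (T : W →L[ℍᵐᵒᵖ] W) {q : ℍ} {z : ℂ} (hre : q.re = z.re)
    (hn : ‖q‖ = ‖z‖) (hq : q ∈ sResolventSet T) (f : Cx W) :
    resolvent (toCx T) z f
      = Ring.inverse (qOp T q) ((starRingEnd ℂ z • f - toCx T f : Cx W) : W) := by
  have hz := ((mem_sResolventSet_iff T hre hn).1 hq).1
  have h1 : toCx (Ring.inverse (qOp T q)) * toCx (qOp T q) = 1 := by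
    rw [← map_mul, Ring.inverse_mul_cancel _ hq, map_one]
  have h2 : resolvent (toCx T) z
      = toCx (Ring.inverse (qOp T q)) * (algebraMap ℂ _ (starRingEnd ℂ z) - toCx T) := by
    have h3 : (algebraMap ℂ _ z - toCx T) * resolvent (toCx T) z = 1 :=
      Ring.mul_inverse_cancel _ hz
    have hcomm : (algebraMap ℂ _ z - toCx T) * (algebraMap ℂ _ (starRingEnd ℂ z) - toCx T)
        = (algebraMap ℂ _ (starRingEnd ℂ z) - toCx T) * (algebraMap ℂ _ z - toCx T) := by
      simp only [Algebra.algebraMap_eq_smul_one, sub_mul, mul_sub, smul_mul_assoc, mul_smul_comm,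
        one_mul, mul_one, smul_sub, smul_smul, mul_comm z]
      abel
    rw [toCx_qOp_eq_mul T hre hn, hcomm] at h1
    calc resolvent (toCx T) z = 1 * resolvent (toCx T) z := (one_mul _).symm
      _ = _ := by rw [← h1, mul_assoc, mul_assoc, h3, mul_one]
  rw [h2, Algebra.algebraMap_eq_smul_one]
  rfl

/-- `q ↦ Q_q(T)` is continuous into the Banach algebra of complex operators, whose units form an
open set. -/
theorem isOpen_sResolventSet [CompleteSpace W] (T : W →L[ℍᵐᵒᵖ] W) : IsOpen (sResolventSet T) := by
  have h : sResolventSet T = (fun q : ℍ => toCx T ^ 2 - ((2 * q.re : ℝ) : ℂ) • toCx T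
      + ((‖q‖ ^ 2 : ℝ) : ℂ) • (1 : Cx W →L[ℂ] Cx W)) ⁻¹' {A | IsUnit A} := by
    ext q
    rw [sResolventSet, mem_ofPred_eq, ← isUnit_toCx, toCx_qOp]
    rfl
  rw [h]
  refine Units.isOpen.preimage ?_
  have := Quaternion.continuous_re
  fun_prop

theorem isClosed_sSpectrum [CompleteSpace W] (T : W →L[ℍᵐᵒᵖ] W) : IsClosed (sSpectrum T) :=
  (isOpen_sResolventSet T).isClosed_compl

theorem isBounded_sSpectrum [CompleteSpace W] (T : W →L[ℍᵐᵒᵖ] W) :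
    Bornology.IsBounded (sSpectrum T) := by
  -- The factor `‖1‖` covers the zero space, where the identity has norm zero.
  refine (Metric.isBounded_closedBall (x := (0 : ℍ))
    (r := ‖toCx T‖ * ‖(1 : Cx W →L[ℂ] Cx W)‖)).subset fun q hq => ?_
  rw [mem_closedBall_zero_iff]
  by_contra! h
  refine hq ((mem_sResolventSet_iff T (z := upperPt q) rfl (norm_upperPt q).symm).2 ⟨?_, ?_⟩) <;>
    refine spectrum.mem_resolventSet_of_norm_lt_mul ?_
  · rwa [norm_upperPt]
  · rwa [RCLike.norm_conj, norm_upperPt]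

theorem isAxiallySymmetric_sSpectrum (T : W →L[ℍᵐᵒᵖ] W) : IsAxiallySymmetric (sSpectrum T) := by
  intro q hq p hp hpT
  have h := upperPt_of_mem_sphere hp
  refine hq ((mem_sResolventSet_iff T (z := upperPt q) rfl (norm_upperPt q).symm).2 ?_)
  rw [← h]
  exact (mem_sResolventSet_iff T (z := upperPt p) rfl (norm_upperPt p).symm).1 hpT

/-- The integral of the resolvent over curves with constant winding number around the spectrum. -/
theorem sum_integral_resolvent_apply [CompleteSpace W] (T : W →L[ℍᵐᵒᵖ] W) {I : ℍ}
    (hI : I ∈ imagUnits) {n : ℕ} {γ : Fin n → ℝ → ℂ} (hγ : ∀ k, IsC1JordanCurve (γ k))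
    (hres : ∀ k, ∀ t ∈ Icc (0 : ℝ) 1, sliceEmb I (γ k t) ∈ sResolventSet T) {D : Set ℂ}
    (hD : IsOpen D) (hsub : ∀ z, sliceEmb I z ∈ sSpectrum T → z ∈ D)
    (hdisj : ∀ k, ∀ t ∈ Icc (0 : ℝ) 1, γ k t ∉ D) {c : ℂ} (hc : ∀ w ∈ D, windingNumber γ w = c)
    (f : Cx W) :
    ∑ k, ∫ t in (0 : ℝ)..1, deriv (γ k) t • resolvent (toCx T) (γ k t) f
      = (2 * Real.pi * Complex.I * c) • f := by
  have hmem : ∀ z, sliceEmb I z ∈ sResolventSet T → z ∈ resolventSet ℂ (toCx T) := fun z hz =>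
    ((mem_sResolventSet_iff T (re_sliceEmb hI z) (norm_sliceEmb hI z)).1 hz).1
  have hres' : ∀ k, ∀ t ∈ Icc (0 : ℝ) 1, γ k t ∈ resolventSet ℂ (toCx T) := fun k t ht =>
    hmem _ (hres k t ht)
  have h := congrArg (fun A : Cx W →L[ℂ] Cx W => A f) (sum_integral_resolvent (toCx T) hγ hres' hD
    (fun z hz => hsub z fun h => hz (hmem z h)) hdisj hc)
  simp only [sum_apply] at h
  rw [smul_apply, one_apply_eq_self] at h
  rw [← h]
  refine Finset.sum_congr rfl fun k _ => ?_
  rw [ContinuousLinearMap.intervalIntegral_apply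
    ((hγ k).intervalIntegrable_smul_resolvent (hres' k))]
  rfl

end Complexification

/-! ### Operators which commute with a projection -/

section Decomposition

variable {V : Type*} [NormedAddCommGroup V] [Module ℍᵐᵒᵖ V]

theorem apply_of_mem_range {P : V →L[ℍᵐᵒᵖ] V} (hP : IsIdempotentElem P) {x : V}
    (hx : x ∈ LinearMap.range (P : V →ₗ[ℍᵐᵒᵖ] V)) : P x = x := by
  obtain ⟨y, rfl⟩ := hx
  exact DFunLike.congr_fun hP y

theorem sub_mem_ker {P : V →L[ℍᵐᵒᵖ] V} (hP : IsIdempotentElem P) (x : V) :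
    x - P x ∈ LinearMap.ker (P : V →ₗ[ℍᵐᵒᵖ] V) := by
  have h : P (P x) = P x := DFunLike.congr_fun hP x
  rw [LinearMap.mem_ker]
  change P (x - P x) = 0
  rw [map_sub, h, sub_self]

/-- `A` is block diagonal for `V = R(P) ⊕ N(P)`. An inverse of `A` commutes with `P` and restricts
to both summands; conversely, inverses of the blocks add up. -/
theorem isUnit_iff_isUnit_range_ker {A P : V →L[ℍᵐᵒᵖ] V} (hP : IsIdempotentElem P)
    (hAP : A * P = P * A)
    {A₁ : LinearMap.range (P : V →ₗ[ℍᵐᵒᵖ] V) →L[ℍᵐᵒᵖ] LinearMap.range (P : V →ₗ[ℍᵐᵒᵖ] V)}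
    {A₂ : LinearMap.ker (P : V →ₗ[ℍᵐᵒᵖ] V) →L[ℍᵐᵒᵖ] LinearMap.ker (P : V →ₗ[ℍᵐᵒᵖ] V)}
    (h₁ : ∀ x, (A₁ x : V) = A x) (h₂ : ∀ x, (A₂ x : V) = A x) :
    IsUnit A ↔ IsUnit A₁ ∧ IsUnit A₂ := by
  have hc : ∀ x, A (P x) = P (A x) := fun x => DFunLike.congr_fun hAP x
  constructor
  · intro h
    obtain ⟨B, hB1, hB2⟩ := isUnit_iff_exists.1 h
    have hAB : ∀ x, A (B x) = x := fun x => DFunLike.congr_fun hB1 x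
    have hBA : ∀ x, B (A x) = x := fun x => DFunLike.congr_fun hB2 x
    have hBP : ∀ x, B (P x) = P (B x) := fun x => by
      conv_lhs => rw [← hAB x, ← hc, hBA]
    constructor
    · refine isUnit_iff_exists.2 ⟨B.restrict (p := LinearMap.range (P : V →ₗ[ℍᵐᵒᵖ] V))
        (q := LinearMap.range (P : V →ₗ[ℍᵐᵒᵖ] V)) ?_, ?_, ?_⟩
      · rintro _ ⟨y, rfl⟩
        exact ⟨B y, (hBP y).symm⟩
      · ext x
        exact (h₁ _).trans (hAB x)
      · ext x
        exact (congrArg B (h₁ x)).trans (hBA x)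
    · refine isUnit_iff_exists.2 ⟨B.restrict (p := LinearMap.ker (P : V →ₗ[ℍᵐᵒᵖ] V))
        (q := LinearMap.ker (P : V →ₗ[ℍᵐᵒᵖ] V)) ?_, ?_, ?_⟩
      · intro x hx
        change P (B x) = 0
        rw [← hBP, show P x = 0 from hx, map_zero]
      · ext x
        exact (h₂ _).trans (hAB x)
      · ext x
        exact (congrArg B (h₂ x)).trans (hBA x)
  · rintro ⟨hu₁, hu₂⟩
    obtain ⟨B₁, hAB₁, hBA₁⟩ := isUnit_iff_exists.1 hu₁
    obtain ⟨B₂, hAB₂, hBA₂⟩ := isUnit_iff_exists.1 hu₂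
    let π₁ : V →L[ℍᵐᵒᵖ] LinearMap.range (P : V →ₗ[ℍᵐᵒᵖ] V) :=
      P.codRestrict _ fun x => ⟨x, rfl⟩
    let π₂ : V →L[ℍᵐᵒᵖ] LinearMap.ker (P : V →ₗ[ℍᵐᵒᵖ] V) :=
      (1 - P).codRestrict _ fun x => sub_mem_ker hP x
    have hπ : ∀ x, (π₁ x : V) + π₂ x = x := fun x => add_sub_cancel (P x) x
    have hπ₁ : ∀ x, π₁ (A x) = A₁ (π₁ x) := fun x => Subtype.ext <| by
      rw [h₁]
      exact (hc x).symm
    have hπ₂ : ∀ x, π₂ (A x) = A₂ (π₂ x) := fun x => Subtype.ext <| by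
      rw [h₂]
      change A x - P (A x) = A (x - P x)
      rw [map_sub, hc]
    refine isUnit_iff_exists.2 ⟨(Submodule.subtypeL _).comp (B₁.comp π₁)
      + (Submodule.subtypeL _).comp (B₂.comp π₂), ?_, ?_⟩
    · ext x
      change A (B₁ (π₁ x) + B₂ (π₂ x)) = x
      have e₁ : A₁ (B₁ (π₁ x)) = π₁ x := DFunLike.congr_fun hAB₁ _
      have e₂ : A₂ (B₂ (π₂ x)) = π₂ x := DFunLike.congr_fun hAB₂ _
      rw [map_add, ← h₁, ← h₂, e₁, e₂, hπ]
    · ext x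
      change ((B₁ (π₁ (A x)) : V) + B₂ (π₂ (A x)) : V) = x
      have e₁ : B₁ (A₁ (π₁ x)) = π₁ x := DFunLike.congr_fun hBA₁ _
      have e₂ : B₂ (A₂ (π₂ x)) = π₂ x := DFunLike.congr_fun hBA₂ _
      rw [hπ₁, hπ₂, e₁, e₂, hπ]

variable {T P : V →L[ℍᵐᵒᵖ] V}

theorem coe_rangePart (hP : IsIdempotentElem P) (hTP : T * P = P * T)
    (x : LinearMap.range (P : V →ₗ[ℍᵐᵒᵖ] V)) : (rangePart T P hTP x : V) = T x :=
  congrArg T (apply_of_mem_range hP x.2)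

theorem coe_kerPart (hTP : T * P = P * T) (x : LinearMap.ker (P : V →ₗ[ℍᵐᵒᵖ] V)) :
    (kerPart T P hTP x : V) = T x := by
  change T (x - P x) = T x
  rw [show P x = 0 from x.2, sub_zero]

variable [NormedSpace ℝ V] [IsScalarTower ℝ ℍᵐᵒᵖ V]

theorem coe_qOp {p : Submodule ℍᵐᵒᵖ V} {S : p →L[ℍᵐᵒᵖ] p} (hS : ∀ x, (S x : V) = T x) (q : ℍ)
    (x : p) : (qOp S q x : V) = qOp T q x := by
  change (S (S x) : V) - ((2 * q.re) • S x : p) + ((‖q‖ ^ 2) • x : p)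
    = T (T x) - (2 * q.re) • T x + (‖q‖ ^ 2) • (x : V)
  rw [hS, hS, ← hS x]
  rfl

theorem qOp_mul_comm (hTP : T * P = P * T) (q : ℍ) : qOp T q * P = P * qOp T q := by
  have h : Commute T P := hTP
  have h2 : Commute (T ^ 2) P := h.pow_left 2
  have hs : ∀ r : ℝ, ∀ A : V →L[ℍᵐᵒᵖ] V, Commute A P → Commute (r • A) P := fun r A hA => by
    ext x
    change r • A (P x) = P (r • A x)
    rw [real_smul_eq, real_smul_eq, P.map_smul]
    exact congrArg _ (DFunLike.congr_fun hA x)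
  exact ((h2.sub_left (hs _ _ h)).add_left (hs _ _ (Commute.one_left P)))

theorem sResolventSet_eq_inter (hP : IsIdempotentElem P) (hTP : T * P = P * T) :
    sResolventSet T
      = sResolventSet (rangePart T P hTP) ∩ sResolventSet (kerPart T P hTP) := by
  ext q
  exact isUnit_iff_isUnit_range_ker hP (qOp_mul_comm hTP q) (coe_qOp (coe_rangePart hP hTP) q)
    (coe_qOp (coe_kerPart hTP) q)

theorem sSpectrum_eq_union (hP : IsIdempotentElem P) (hTP : T * P = P * T) :
    sSpectrum T = sSpectrum (rangePart T P hTP) ∪ sSpectrum (kerPart T P hTP) := by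
  rw [sSpectrum, sResolventSet_eq_inter hP hTP, compl_inter]
  rfl

variable [NormSMulClass ℍᵐᵒᵖ V]

instance (p : Submodule ℍᵐᵒᵖ V) : NormSMulClass ℍᵐᵒᵖ p where
  norm_smul q x := norm_smul q (x : V)

/-- The inclusion of a subspace, as a complex linear map. -/
def subtypeCx (p : Submodule ℍᵐᵒᵖ V) : Cx p →L[ℂ] Cx V where
  toFun x := ((show p from x) : V)
  map_add' _ _ := rfl
  map_smul' _ _ := rfl
  cont := continuous_subtype_val

/-- The inclusion intertwines `z - S` with `z - T`, hence also their inverses. -/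
theorem resolvent_subtypeCx {p : Submodule ℍᵐᵒᵖ V} {S : p →L[ℍᵐᵒᵖ] p}
    (hS : ∀ x, (S x : V) = T x) {z : ℂ} (hz : z ∈ resolventSet ℂ (toCx T))
    (hz' : z ∈ resolventSet ℂ (toCx S)) (x : Cx p) :
    resolvent (toCx T) z (subtypeCx p x) = subtypeCx p (resolvent (toCx S) z x) := by
  have h1 : resolvent (toCx T) z * (algebraMap ℂ _ z - toCx T) = 1 := Ring.inverse_mul_cancel _ hz
  have h2 : (algebraMap ℂ _ z - toCx S) * resolvent (toCx S) z = 1 := Ring.mul_inverse_cancel _ hz'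
  have h3 : ∀ y, subtypeCx p ((algebraMap ℂ _ z - toCx S) y)
      = (algebraMap ℂ _ z - toCx T) (subtypeCx p y) := fun y =>
    congrArg (fun w : V => (show V from z • subtypeCx p y) - w) (hS y)
  calc resolvent (toCx T) z (subtypeCx p x)
      = resolvent (toCx T) z
          (subtypeCx p (((algebraMap ℂ _ z - toCx S) * resolvent (toCx S) z) x)) := by
        rw [h2]
        rfl
    _ = (resolvent (toCx T) z * (algebraMap ℂ _ z - toCx T))
          (subtypeCx p (resolvent (toCx S) z x)) := by
        rw [mul_apply_eq_comp, h3, mul_apply_eq_comp]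
    _ = _ := by
        rw [h1]
        rfl

theorem mem_resolventSet_of_sliceEmb {W : Type*} [NormedAddCommGroup W] [NormedSpace ℝ W]
    [Module ℍᵐᵒᵖ W] [IsScalarTower ℝ ℍᵐᵒᵖ W] [NormSMulClass ℍᵐᵒᵖ W] {S : W →L[ℍᵐᵒᵖ] W} {I : ℍ}
    (hI : I ∈ imagUnits) {z : ℂ} (hz : sliceEmb I z ∈ sResolventSet S) :
    z ∈ resolventSet ℂ (toCx S) :=
  ((mem_sResolventSet_iff S (re_sliceEmb hI z) (norm_sliceEmb hI z)).1 hz).1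

theorem intervalIntegrable_smul_resolvent_apply {W : Type*} [NormedAddCommGroup W]
    [NormedSpace ℝ W] [Module ℍᵐᵒᵖ W] [IsScalarTower ℝ ℍᵐᵒᵖ W] [NormSMulClass ℍᵐᵒᵖ W]
    [CompleteSpace W] {S : W →L[ℍᵐᵒᵖ] W} {I : ℍ} (hI : I ∈ imagUnits) {γ : ℝ → ℂ}
    (hγ : IsC1JordanCurve γ)
    (hres : ∀ t ∈ Icc (0 : ℝ) 1, sliceEmb I (γ t) ∈ sResolventSet S) (x : Cx W) :
    IntervalIntegrable (fun t => deriv γ t • resolvent (toCx S) (γ t) x)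
      MeasureTheory.volume 0 1 := by
  have h := hγ.intervalIntegrable_smul_resolvent (a := toCx S) fun t ht =>
    mem_resolventSet_of_sliceEmb hI (hres t ht)
  exact ⟨(ContinuousLinearMap.apply ℂ (Cx W) x).integrable_comp h.1,
    (ContinuousLinearMap.apply ℂ (Cx W) x).integrable_comp h.2⟩

/-- The integral of the resolvent on a vector of an invariant subspace. -/
theorem sum_integral_resolvent_subtypeCx {p : Submodule ℍᵐᵒᵖ V} [CompleteSpace p] [CompleteSpace V]
    {S : p →L[ℍᵐᵒᵖ] p} (hS : ∀ x, (S x : V) = T x) {I : ℍ}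
    (hI : I ∈ imagUnits) {n : ℕ} {γ : Fin n → ℝ → ℂ} (hγ : ∀ k, IsC1JordanCurve (γ k))
    (hT : ∀ k, ∀ t ∈ Icc (0 : ℝ) 1, sliceEmb I (γ k t) ∈ sResolventSet T)
    (hres : ∀ k, ∀ t ∈ Icc (0 : ℝ) 1, sliceEmb I (γ k t) ∈ sResolventSet S) {D : Set ℂ}
    (hD : IsOpen D) (hsub : ∀ z, sliceEmb I z ∈ sSpectrum S → z ∈ D)
    (hdisj : ∀ k, ∀ t ∈ Icc (0 : ℝ) 1, γ k t ∉ D) {c : ℂ} (hc : ∀ w ∈ D, windingNumber γ w = c)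
    (x : Cx p) :
    ∑ k, ∫ t in (0 : ℝ)..1, deriv (γ k) t • resolvent (toCx T) (γ k t) (subtypeCx p x)
      = (2 * Real.pi * Complex.I * c) • subtypeCx p x := by
  rw [← map_smul, ← sum_integral_resolvent_apply S hI hγ hres hD hsub hdisj hc x, map_sum]
  refine Finset.sum_congr rfl fun k _ => ?_
  rw [← ContinuousLinearMap.intervalIntegral_comp_comm]
  · refine intervalIntegral.integral_congr fun t ht => ?_
    rw [uIcc_of_le zero_le_one] at ht
    change _ = subtypeCx p _
    rw [map_smul, ← resolvent_subtypeCx hS (mem_resolventSet_of_sliceEmb hI (hT k t ht))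
      (mem_resolventSet_of_sliceEmb hI (hres k t ht))]
  · exact intervalIntegrable_smul_resolvent_apply hI (hγ k) (hres k) x

end Decomposition

/-! ### Left multiplication -/

section LeftMul

open RightInner (qinner)

variable {V : Type*} [NormedAddCommGroup V] [Module ℍᵐᵒᵖ V] [RightInner V]

theorem qinner_zero (f : V) : qinner f (0 : V) = 0 := by
  have h := RightInner.qinner_smul_add f 0 0 1
  simpa using h

theorem qinner_smul (f g : V) (q : ℍ) : qinner f (op q • g) = qinner f g * q := by
  have h := RightInner.qinner_smul_add f g 0 q
  rwa [add_zero, qinner_zero, add_zero] at h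

theorem qinner_add (f g h : V) : qinner f (g + h) = qinner f g + qinner f h := by
  have h := RightInner.qinner_smul_add f g h 1
  rwa [op_one, one_smul, mul_one] at h

theorem qinner_smul_left (f g : V) (q : ℍ) : qinner (op q • f) g = star q * qinner f g := by
  rw [← RightInner.star_qinner, qinner_smul, star_mul, RightInner.star_qinner]

theorem qinner_add_left (f g h : V) : qinner (f + g) h = qinner f h + qinner g h := by
  rw [← RightInner.star_qinner, qinner_add, star_add, RightInner.star_qinner,
    RightInner.star_qinner]

/-- The inner product forces this: `‖f q‖² = q̄ ⟨f, f⟩ q = |q|² ‖f‖²`. -/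
instance : NormSMulClass ℍᵐᵒᵖ V where
  norm_smul q f := by
    have h := RightInner.qinner_self (op q.unop • f)
    rw [qinner_smul, qinner_smul_left, RightInner.qinner_self, ← Quaternion.coe_commutes, mul_assoc,
      Quaternion.star_mul_self, ← Quaternion.coe_mul, Quaternion.coe_inj,
      Quaternion.normSq_eq_norm_mul_self, MulOpposite.op_unop, MulOpposite.norm_unop] at h
    rw [← sq_eq_sq₀ (norm_nonneg _) (by positivity), ← h]
    ring

variable [NormedSpace ℝ V] [IsScalarTower ℝ ℍᵐᵒᵖ V]

/-- The real inner product `Re ⟨f, g⟩`. -/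
abbrev realInner : InnerProductSpace ℝ V where
  inner f g := (qinner f g).re
  norm_sq_eq_re_inner f := by
    rw [RightInner.qinner_self]
    rfl
  conj_inner_symm f g := by
    rw [← RightInner.star_qinner]
    simp
  add_left f g h := by
    rw [qinner_add_left, Quaternion.re_add]
  smul_left f g r := by
    rw [real_smul_eq, qinner_smul_left]
    simp

/-- The real Cauchy–Schwarz inequality for `f` and `g` times the conjugate of `⟨f, g⟩`, whose real
inner product is `|⟨f, g⟩|²`. -/
theorem norm_qinner_le (f g : V) : ‖qinner f g‖ ≤ ‖f‖ * ‖g‖ := by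
  let _ : InnerProductSpace ℝ V := realInner
  have h : (qinner f (op (star (qinner f g)) • g)).re ≤ _ :=
    real_inner_le_norm f (op (star (qinner f g)) • g)
  rw [qinner_smul, Quaternion.self_mul_star, Quaternion.re_coe, Quaternion.normSq_eq_norm_mul_self,
    norm_smul, MulOpposite.norm_op, Quaternion.norm_star] at h
  rcases (norm_nonneg (qinner f g)).eq_or_lt with h0 | h0
  · rw [← h0]
    positivity
  · nlinarith

theorem continuous_qinner (f : V) : Continuous fun g : V => qinner f g := by
  let φ : V →+ ℍ := ⟨⟨fun g => qinner f g, qinner_zero f⟩, qinner_add f⟩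
  exact AddMonoidHomClass.continuous_of_bound φ ‖f‖ (norm_qinner_le f)

variable {ι : Type*} {e : ι → V}

theorem IsHilbertBasis.norm_basis {V : Type*} [NormedAddCommGroup V] [Module ℍᵐᵒᵖ V]
    [RightInner V] {e : ι → V} (he : IsHilbertBasis e) (k : ι) : ‖e k‖ = 1 := by
  have h := RightInner.qinner_self (e k)
  rw [he.norm_eq_one, ← Quaternion.coe_one, Quaternion.coe_inj] at h
  nlinarith [norm_nonneg (e k)]

/-- The isometry `q ↦ eₖ q`. -/
def IsHilbertBasis.line (he : IsHilbertBasis e) (k : ι) : ℍ →ₗᵢ[ℝ] V where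
  toFun q := op q • e k
  map_add' p q := by rw [op_add, add_smul]
  map_smul' r q := by
    rw [op_smul, smul_assoc]
    rfl
  norm_map' q := by
    change ‖op q • e k‖ = ‖q‖
    rw [norm_smul, he.norm_basis, mul_one, MulOpposite.norm_op]

/-- As a real Hilbert space `V` is the sum of the lines `eₖ ℍ`. Their real span is stable under
right multiplication, hence contains the dense right linear span. -/
theorem IsHilbertBasis.isHilbertSum [CompleteSpace V] (he : IsHilbertBasis e) :
    let _ : InnerProductSpace ℝ V := realInner
    IsHilbertSum ℝ (fun _ : ι => ℍ) he.line := by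
  intro _
  refine IsHilbertSum.mk ?_ ?_
  · intro k l hkl p q
    change (qinner (op p • e k) (op q • e l)).re = 0
    rw [qinner_smul, qinner_smul_left, he.orthogonal k l hkl]
    simp
  · set S := ⨆ k, LinearMap.range (he.line k).toLinearMap with hS
    have hmem : ∀ k q, op q • e k ∈ S := fun k q =>
      Submodule.mem_iSup_of_mem k ⟨q, rfl⟩
    have hsub : (Submodule.span ℍᵐᵒᵖ (range e) : Set V) ⊆ S := by
      intro x hx
      refine Submodule.span_induction ?_ S.zero_mem (fun x y _ _ => S.add_mem) ?_ hx
      · rintro _ ⟨k, rfl⟩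
        simpa using hmem k 1
      · intro q x _ hx
        refine Submodule.iSup_induction _ (motive := fun x => q • x ∈ S) hx ?_ ?_ ?_
        · rintro k _ ⟨p, rfl⟩
          change q • op p • e k ∈ S
          rw [smul_smul]
          exact hmem k (p * q.unop)
        · rw [smul_zero]
          exact S.zero_mem
        · intro x y hx hy
          rw [smul_add]
          exact S.add_mem hx hy
    intro x _
    exact closure_mono hsub (he.dense_span x)

theorem IsHilbertBasis.exists_coords [CompleteSpace V] (he : IsHilbertBasis e) (f : V) :
    ∃ a : lp (fun _ : ι => ℍ) 2, HasSum (fun k => op (a k) • e k) f := by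
  let _ : InnerProductSpace ℝ V := realInner
  have h := he.isHilbertSum
  refine ⟨h.linearIsometryEquiv f, ?_⟩
  have h2 := h.hasSum_linearIsometryEquiv_symm (h.linearIsometryEquiv f)
  rwa [LinearIsometryEquiv.symm_apply_apply] at h2

theorem IsHilbertBasis.exists_hasSum [CompleteSpace V] (he : IsHilbertBasis e)
    (a : lp (fun _ : ι => ℍ) 2) : ∃ f, HasSum (fun k => op (a k) • e k) f := by
  let _ : InnerProductSpace ℝ V := realInner
  exact ⟨_, he.isHilbertSum.hasSum_linearIsometryEquiv_symm a⟩

theorem IsHilbertBasis.qinner_eq_of_hasSum (he : IsHilbertBasis e) {a : ι → ℍ} {f : V}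
    (h : HasSum (fun k => op (a k) • e k) f) (k : ι) : qinner (e k) f = a k := by
  let φ : V →+ ℍ := ⟨⟨fun g => qinner (e k) g, qinner_zero _⟩, qinner_add _⟩
  have h1 := h.map φ (continuous_qinner (e k))
  refine h1.unique ?_
  have h2 : (φ ∘ fun l => op (a l) • e l) k = a k := by
    change qinner (e k) (op (a k) • e k) = a k
    rw [qinner_smul, he.norm_eq_one, one_mul]
  rw [← h2]
  refine hasSum_single k fun l hl => ?_
  change qinner (e k) (op (a l) • e l) = 0
  rw [qinner_smul, he.orthogonal k l hl.symm, zero_mul]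

variable [CompleteSpace V]

theorem IsHilbertBasis.hasSum_repr (he : IsHilbertBasis e) (f : V) :
    HasSum (fun k => op (qinner (e k) f) • e k) f := by
  obtain ⟨a, ha⟩ := he.exists_coords f
  simpa only [he.qinner_eq_of_hasSum ha] using ha

theorem IsHilbertBasis.ext (he : IsHilbertBasis e) {f g : V}
    (h : ∀ k, qinner (e k) f = qinner (e k) g) : f = g := by
  have hf := he.hasSum_repr f
  simp only [h] at hf
  exact hf.unique (he.hasSum_repr g)

/-- The coordinates of `q f` are `q ⟨eₖ, f⟩`. -/
theorem IsHilbertBasis.qinner_leftMul (he : IsHilbertBasis e) (q : ℍ) (f : V) (k : ι) :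
    qinner (e k) (leftMul e q f) = q * qinner (e k) f := by
  obtain ⟨a, ha⟩ := he.exists_coords f
  -- Square summability makes the series defining `leftMul` converge, so that its `tsum` is not the
  -- default value.
  have hmem : Memℓp (fun k => q * a k) 2 := by
    have h : Memℓp (fun k => ‖q‖ • a k) 2 := (lp.memℓp a).const_smul ‖q‖
    refine h.mono' fun k => ?_
    rw [norm_mul, norm_smul, norm_norm]
  obtain ⟨g, hg⟩ := he.exists_hasSum ⟨_, hmem⟩
  have hl : leftMul e q f = g := by
    rw [leftMul]
    simp only [he.qinner_eq_of_hasSum ha]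
    exact hg.tsum_eq
  rw [hl, he.qinner_eq_of_hasSum hg, he.qinner_eq_of_hasSum ha]

theorem IsHilbertBasis.leftMul_mul (he : IsHilbertBasis e) (p q : ℍ) (f : V) :
    leftMul e (p * q) f = leftMul e p (leftMul e q f) :=
  he.ext fun k => by simp only [he.qinner_leftMul, mul_assoc]

theorem IsHilbertBasis.leftMul_sliceEmb (he : IsHilbertBasis e) (I : ℍ) (z : ℂ) (f : V) :
    leftMul e (sliceEmb I z) f = z.re • f + z.im • leftMul e I f :=
  he.ext fun k => by
    rw [he.qinner_leftMul, qinner_add, real_smul_eq, real_smul_eq, qinner_smul, qinner_smul,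
      he.qinner_leftMul, sliceEmb, add_mul, Quaternion.coe_commutes z.re, mul_assoc I,
      Quaternion.coe_commutes z.im, mul_assoc I]

end LeftMul

/-! ### Arithmetic in a slice. -/

theorem sliceEmb_mul {I : ℍ} (hI : I ∈ imagUnits) (z w : ℂ) :
    sliceEmb I (z * w) = sliceEmb I z * sliceEmb I w := by
  have h : I * I = -1 := by
    have h1 := Quaternion.normSq_eq_norm_mul_self I
    rw [hI.2, mul_one, Quaternion.normSq_def'] at h1
    have h2 := hI.1
    ext <;> simp [h2] at h1 ⊢ <;> nlinarith
  simp only [sliceEmb, Complex.mul_re, Complex.mul_im, Quaternion.coe_sub, Quaternion.coe_add,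
    Quaternion.coe_mul]
  have h3 : I * (z.im : ℍ) * (I * (w.im : ℍ)) = -((z.im : ℍ) * w.im) := by
    rw [← Quaternion.coe_commutes z.im I, mul_assoc, ← mul_assoc I I, h]
    simp
  have h4 : I * (z.im : ℍ) * (w.re : ℍ) = I * ((z.im : ℍ) * w.re) := mul_assoc _ _ _
  have h5 : (z.re : ℍ) * (I * (w.im : ℍ)) = I * ((z.re : ℍ) * w.im) := by
    rw [← mul_assoc, ← mul_assoc, Quaternion.coe_commutes]
  rw [add_mul, mul_add, mul_add, mul_add, h3, h4, h5]
  abel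

theorem star_sliceEmb {I : ℍ} (hI : I ∈ imagUnits) (z : ℂ) :
    star (sliceEmb I z) = sliceEmb I (starRingEnd ℂ z) := by
  have := hI.1
  ext <;> simp [sliceEmb, this, mul_comm]

theorem sliceEmb_I (I : ℍ) : sliceEmb I Complex.I = I := by
  simp [sliceEmb]

theorem neg_sliceEmb (I : ℍ) (z : ℂ) : -sliceEmb I z = sliceEmb I (-z) := by
  simp [sliceEmb, add_comm]

/-! ### The contour integral of the complex resolvent of `T`. -/

section RieszProjection

variable {V : Type*} [NormedAddCommGroup V] [NormedSpace ℝ V] [Module ℍᵐᵒᵖ V]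
  [IsScalarTower ℝ ℍᵐᵒᵖ V]

theorem continuous_sliceEmb (I : ℍ) : Continuous (sliceEmb I) := by
  have h1 : Continuous fun z : ℂ => (z.re : ℍ) :=
    Quaternion.continuous_coe.comp Complex.continuous_re
  have h2 : Continuous fun z : ℂ => (z.im : ℍ) :=
    Quaternion.continuous_coe.comp Complex.continuous_im
  exact h1.add (continuous_const.mul h2)

theorem isOpen_slice (I : ℍ) {U : Set ℍ} (hU : IsOpen U) : IsOpen (slice I U) :=
  hU.preimage (continuous_sliceEmb I)

/-- The range of an idempotent is its fixed-point set, which is closed. -/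
theorem completeSpace_range {V : Type*} [NormedAddCommGroup V] [Module ℍᵐᵒᵖ V]
    [CompleteSpace V] {P : V →L[ℍᵐᵒᵖ] V} (hP : IsIdempotentElem P) :
    CompleteSpace (LinearMap.range (P : V →ₗ[ℍᵐᵒᵖ] V)) := by
  have h : (LinearMap.range (P : V →ₗ[ℍᵐᵒᵖ] V) : Set V) = {x | P x = x} := by
    ext x
    exact ⟨apply_of_mem_range hP, fun hx => ⟨x, hx⟩⟩
  have hc : IsClosed (LinearMap.range (P : V →ₗ[ℍᵐᵒᵖ] V) : Set V) := by
    rw [h]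
    exact isClosed_eq P.continuous continuous_id
  exact hc.completeSpace_coe

theorem completeSpace_ker {V : Type*} [NormedAddCommGroup V] [Module ℍᵐᵒᵖ V]
    [CompleteSpace V] (P : V →L[ℍᵐᵒᵖ] V) :
    CompleteSpace (LinearMap.ker (P : V →ₗ[ℍᵐᵒᵖ] V)) := by
  have hc : IsClosed (LinearMap.ker (P : V →ₗ[ℍᵐᵒᵖ] V) : Set V) :=
    isClosed_eq P.continuous continuous_const
  exact hc.completeSpace_coe

variable {T P : V →L[ℍᵐᵒᵖ] V}

theorem IsPositiveBoundary.mem_frontier {D : Set ℂ} {n : ℕ} {γ : Fin n → ℝ → ℂ}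
    (h : IsPositiveBoundary D γ) (k : Fin n) {t : ℝ} (ht : t ∈ Icc (0 : ℝ) 1) :
    γ k t ∈ frontier D := by
  rw [← h.iUnion_image]
  exact mem_iUnion.2 ⟨k, mem_image_of_mem _ ht⟩

theorem IsRieszDomain.mem_sResolventSet {σ U : Set ℍ} (hU : IsRieszDomain T σ U) {I : ℍ}
    (hI : I ∈ imagUnits) {z : ℂ} (hz : z ∈ frontier (slice I U)) :
    sliceEmb I z ∈ sResolventSet T :=
  hU.frontier_subset I hI (mem_image_of_mem _ hz)

/-- The integral of the resolvent of the underlying complex operator is `2 π i P`. -/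
theorem sum_integral_resolvent_eq [NormSMulClass ℍᵐᵒᵖ V] [CompleteSpace V]
    (hP : IsIdempotentElem P) (hTP : T * P = P * T)
    (hdisj : Disjoint (sSpectrum (rangePart T P hTP)) (sSpectrum (kerPart T P hTP))) {U : Set ℍ}
    (hU : IsRieszDomain T (sSpectrum (rangePart T P hTP)) U) {I : ℍ} (hI : I ∈ imagUnits) {n : ℕ}
    {γ : Fin n → ℝ → ℂ} (hγ : IsPositiveBoundary (slice I U) γ) (v : Cx V) :
    ∑ k, ∫ t in (0 : ℝ)..1, deriv (γ k) t • resolvent (toCx T) (γ k t) v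
      = (2 * Real.pi * Complex.I) • toCx P v := by
  have := completeSpace_range hP
  have := completeSpace_ker P
  have hopen := isOpen_slice I hU.isOpen
  have hfr : ∀ k, ∀ t ∈ Icc (0 : ℝ) 1, γ k t ∈ frontier (slice I U) := fun k t =>
    hγ.mem_frontier k
  have hT : ∀ k, ∀ t ∈ Icc (0 : ℝ) 1, sliceEmb I (γ k t) ∈ sResolventSet T := fun k t ht =>
    hU.mem_sResolventSet hI (hfr k t ht)
  have h12 := sResolventSet_eq_inter hP hTP
  have hspec := sSpectrum_eq_union hP hTP
  have h1 : ∀ x, ∑ k, ∫ t in (0 : ℝ)..1, deriv (γ k) t • resolvent (toCx T) (γ k t)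
      (subtypeCx (LinearMap.range (P : V →ₗ[ℍᵐᵒᵖ] V)) x)
      = (2 * Real.pi * Complex.I * 1) • subtypeCx _ x := by
    refine sum_integral_resolvent_subtypeCx (coe_rangePart hP hTP) hI hγ.isC1JordanCurve hT
      (fun k t ht => (h12 ▸ hT k t ht).1) hopen (fun z hz => ?_) (fun k t ht h => ?_)
      hγ.winding_inside
    · rw [← hU.inter_eq] at hz
      exact hz.1
    · have := hfr k t ht
      rw [hopen.frontier_eq] at this
      exact this.2 h
  have h2 : ∀ x, ∑ k, ∫ t in (0 : ℝ)..1, deriv (γ k) t • resolvent (toCx T) (γ k t)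
      (subtypeCx (LinearMap.ker (P : V →ₗ[ℍᵐᵒᵖ] V)) x)
      = (2 * Real.pi * Complex.I * 0) • subtypeCx _ x := by
    -- Here the open set is the exterior of the contour, with winding number `0`. It contains the
    -- slice of `σ_S(T₂)`: a point of it in `U` would lie in `σ_S(T₁)`, and the frontier consists of
    -- regular points.
    refine sum_integral_resolvent_subtypeCx (coe_kerPart hTP) hI hγ.isC1JordanCurve hT
      (fun k t ht => (h12 ▸ hT k t ht).2) isClosed_closure.isOpen_compl (fun z hz hzc => ?_)
      (fun k t ht h => h (frontier_subset_closure (hfr k t ht))) hγ.winding_outside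
    have hzT : sliceEmb I z ∈ sSpectrum T := hspec ▸ Or.inr hz
    rw [closure_eq_self_union_frontier] at hzc
    rcases hzc with hzc | hzc
    · exact disjoint_left.1 hdisj (hU.inter_eq ▸ ⟨hzc, hzT⟩) hz
    · exact hzT (hU.mem_sResolventSet hI hzc)
  have h1' := h1 ⟨P v, ⟨v, rfl⟩⟩
  have h2' := h2 ⟨(show V from v) - P v, sub_mem_ker hP v⟩
  rw [mul_one] at h1'
  rw [mul_zero, zero_smul] at h2'
  have hadd := congrArg₂ (· + ·) h1' h2'
  simp only [← Finset.sum_add_distrib, add_zero] at hadd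
  refine Eq.trans (Finset.sum_congr rfl fun k _ => ?_) hadd
  rw [← intervalIntegral.integral_add]
  · refine intervalIntegral.integral_congr fun t _ => ?_
    rw [← smul_add, ← map_add]
    congr 2
    exact (add_sub_cancel (P v) (show V from v)).symm
  · exact intervalIntegrable_smul_resolvent_apply hI (hγ.isC1JordanCurve k) (hT k) _
  · exact intervalIntegrable_smul_resolvent_apply hI (hγ.isC1JordanCurve k) (hT k) _

theorem Cx.smul_eq [NormSMulClass ℍᵐᵒᵖ V] (w : ℂ) (v : V) :
    (w • (show Cx V from v) : Cx V) = (w.re • v + w.im • op (Complex.I : ℍ) • v : V) := by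
  change op (w : ℍ) • v = _
  rw [real_smul_eq, real_smul_eq, smul_smul, ← add_smul, ← op_mul, ← op_add]
  congr 2
  ext <;> simp

end RieszProjection

/-! ### The Riesz integral expressed by complex resolvents. -/

section Integrand

variable {V : Type*} [NormedAddCommGroup V] [NormedSpace ℝ V] [Module ℍᵐᵒᵖ V]
  [IsScalarTower ℝ ℍᵐᵒᵖ V] [RightInner V] [CompleteSpace V] {ι : Type*} {e : ι → V}

/-- The quaternion `j`. -/
def quatJ : ℍ := ⟨0, 0, 1, 0⟩

theorem opI_mul_opI : op (Complex.I : ℍ) * op (Complex.I : ℍ) = -1 := by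
  rw [← op_mul, ← op_one, ← op_neg]
  congr 1
  ext <;> simp

theorem opJ_mul_opJ : op quatJ * op quatJ = -1 := by
  rw [← op_mul, ← op_one, ← op_neg]
  congr 1
  have h : quatJ.re = 0 ∧ quatJ.imI = 0 ∧ quatJ.imJ = 1 ∧ quatJ.imK = 0 := ⟨rfl, rfl, rfl, rfl⟩
  ext <;> simp [h]

theorem opJ_mul_opI_mul_opJ : op quatJ * op (Complex.I : ℍ) * op quatJ = op (Complex.I : ℍ) := by
  rw [← op_mul, ← op_mul]
  congr 1
  have h : quatJ.re = 0 ∧ quatJ.imI = 0 ∧ quatJ.imJ = 1 ∧ quatJ.imK = 0 := ⟨rfl, rfl, rfl, rfl⟩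
  ext <;> simp [h]

/-- The integrand of the Riesz projection in terms of the resolvent of the underlying complex
operator. -/
theorem sLeftResolvent_eq (he : IsHilbertBasis e) (T : V →L[ℍᵐᵒᵖ] V) {I : ℍ}
    (hI : I ∈ imagUnits) {z w : ℂ} (hz : sliceEmb I z ∈ sResolventSet T) (f : V) :
    let F : V → V := fun v => (w • resolvent (toCx T) z v : Cx V)
    let h := leftMul e I f
    sLeftResolvent e T (sliceEmb I z) (leftMul e (-(sliceEmb I w * I)) f)
      = (-(1 / 2) : ℝ) • (op (Complex.I : ℍ) • (F f + op quatJ • F (op quatJ • f))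
        + (F h - op quatJ • F (op quatJ • h))) := by
  intro F h
  set R := Ring.inverse (qOp T (sliceEmb I z)) with hR
  set i : ℍᵐᵒᵖ := op (Complex.I : ℍ) with hi
  set j : ℍᵐᵒᵖ := op quatJ with hj
  have hii : i * i = -1 := opI_mul_opI
  have hjj : j * j = -1 := opJ_mul_opJ
  have hjij : j * i * j = i := opJ_mul_opI_mul_opJ
  -- `F v` splits as `A v + (B v) i` with `A` and `B` commuting with right multiplication by `j`;
  -- the integrand to be found is `B f - A h`.
  let A : V → V := fun v => R ((z.re * w.re + z.im * w.im) • v - w.re • T v)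
  let B : V → V := fun v => R ((z.re * w.im - z.im * w.re) • v - w.im • T v)
  have hcomm : ∀ (r : ℝ) (q : ℍᵐᵒᵖ) (v : V), r • q • v = q • r • v := fun r q v =>
    smul_comm r q v
  have hF : ∀ v, F v = A v + i • B v := fun v => by
    have h1 : F v = R ((starRingEnd ℂ z • w • (show Cx V from v) : Cx V)
        - toCx T (w • (show Cx V from v)) : Cx V) := by
      have h2 := resolvent_toCx_apply T (re_sliceEmb hI z) (norm_sliceEmb hI z) hz
        (w • (show Cx V from v))
      rw [map_smul] at h2
      exact h2
    rw [h1, Cx.smul_eq w v]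
    change R ((show V from starRingEnd ℂ z • (show Cx V from w.re • v + w.im • i • v))
      - T (w.re • v + w.im • i • v) : V) = _
    rw [Cx.smul_eq, ← hi]
    simp only [Complex.conj_re, Complex.conj_im]
    change _ = R _ + i • R _
    rw [← R.map_smul, ← R.map_add]
    congr 1
    have e1 : ∀ v : V, i • i • v = -v := fun v => by rw [smul_smul, hii, neg_smul, one_smul]
    have e2 : ∀ (r : ℝ) (v : V), i • r • v = r • i • v := fun r v => (hcomm r i v).symm
    simp only [map_add, T.map_smul, T.map_smul_of_tower, smul_add, smul_sub, e1, e2, smul_neg]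
    generalize i • T v = a
    generalize i • v = b
    module
  have hA : ∀ v, A (j • v) = j • A v := fun v => by
    change R _ = j • R _
    rw [← R.map_smul, smul_sub, T.map_smul, hcomm, hcomm]
  have hB : ∀ v, B (j • v) = j • B v := fun v => by
    change R _ = j • R _
    rw [← R.map_smul, smul_sub, T.map_smul, hcomm, hcomm]
  -- As `j² = -1` and `j i j = i`, this reverses `A` and keeps `B`, so sums and differences with `F
  -- v` isolate the two parts.
  have hFj : ∀ v, j • F (j • v) = -A v + i • B v := fun v => by
    rw [hF, hA, hB, smul_add, smul_smul, smul_smul, smul_smul, hjj, hjij, neg_smul,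
      one_smul]
  have hright : (-(1 / 2) : ℝ) • (i • (F f + j • F (j • f)) + (F h - j • F (j • h)))
      = B f - A h := by
    have e1 : F f + j • F (j • f) = (2 : ℝ) • i • B f := by
      rw [hFj, hF]
      generalize i • B _ = b
      module
    have e2 : F h - j • F (j • h) = (2 : ℝ) • A h := by
      rw [hFj, hF]
      generalize i • B _ = b
      module
    rw [e1, e2, ← hcomm, smul_smul i i, hii, neg_smul (1 : ℍᵐᵒᵖ), one_smul]
    module
  rw [hright]
  have hw : -(sliceEmb I w * I) = sliceEmb I (-(w * Complex.I)) := by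
    rw [← neg_sliceEmb, sliceEmb_mul hI, sliceEmb_I]
  have hg : leftMul e (-(sliceEmb I w * I)) f = w.im • f - w.re • h := by
    rw [hw, he.leftMul_sliceEmb]
    simp [sub_eq_add_neg, h]
  have hg' : leftMul e I (leftMul e (-(sliceEmb I w * I)) f) = w.re • f + w.im • h := by
    rw [← he.leftMul_mul, hw]
    nth_rw 1 [← sliceEmb_I I]
    rw [← sliceEmb_mul hI, show Complex.I * -(w * Complex.I) = w by
      linear_combination (-w) * Complex.I_mul_I, he.leftMul_sliceEmb]
  rw [sLeftResolvent, star_sliceEmb hI, he.leftMul_sliceEmb, hg', hg]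
  change -R _ = R _ - R _
  rw [← map_neg, ← map_sub]
  congr 1
  simp only [map_sub, T.map_smul_of_tower, Complex.conj_re, Complex.conj_im]
  module

theorem integral_right_smul (q : ℍᵐᵒᵖ) {G : ℝ → V}
    (hG : IntervalIntegrable G MeasureTheory.volume 0 1) :
    ∫ t in (0 : ℝ)..1, q • G t = q • ∫ t in (0 : ℝ)..1, G t := by
  let L : V →L[ℝ] V :=
    { toFun := fun v => q • v
      map_add' := smul_add q
      map_smul' := fun r v => smul_comm q r v
      cont := continuous_const_smul q }
  exact L.intervalIntegral_comp_comm hG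

/-- Each resolvent integral is `2πi P`, and `P` commutes with right multiplication by `j`. The two
terms in `h = I f` then cancel, and those in `f` add up to `i · 4πi P f = -4π P f`, which the
factors `-1/2` and `1/(2π)` turn into `P f`. -/
theorem rieszIntegral_eq (he : IsHilbertBasis e) {T P : V →L[ℍᵐᵒᵖ] V}
    (hP : IsIdempotentElem P) (hTP : T * P = P * T)
    (hdisj : Disjoint (sSpectrum (rangePart T P hTP)) (sSpectrum (kerPart T P hTP))) {U : Set ℍ}
    (hU : IsRieszDomain T (sSpectrum (rangePart T P hTP)) U) {I : ℍ} (hI : I ∈ imagUnits) {n : ℕ}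
    {γ : Fin n → ℝ → ℂ} (hγ : IsPositiveBoundary (slice I U) γ) (f : V) :
    rieszIntegral e T I γ f = P f := by
  have hT : ∀ k, ∀ t ∈ Icc (0 : ℝ) 1, sliceEmb I (γ k t) ∈ sResolventSet T := fun k t ht =>
    hU.mem_sResolventSet hI (hγ.mem_frontier k ht)
  let F : Fin n → V → ℝ → V := fun k v t =>
    (deriv (γ k) t • resolvent (toCx T) (γ k t) v : Cx V)
  have hint : ∀ k v, IntervalIntegrable (F k v) MeasureTheory.volume 0 1 := fun k v =>
    intervalIntegrable_smul_resolvent_apply hI (hγ.isC1JordanCurve k) (hT k) v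
  have hsum : ∀ v : V, ∑ k, ∫ t in (0 : ℝ)..1, F k v t
      = (2 * Real.pi) • op (Complex.I : ℍ) • P v := fun v => by
    have h := sum_integral_resolvent_eq hP hTP hdisj hU hI hγ v
    simp only [Cx.integral_eq] at h
    refine Eq.trans h ?_
    change ((2 * Real.pi * Complex.I : ℂ) • (show Cx V from P v) : Cx V) = _
    rw [Cx.smul_eq]
    simp
    rfl
  set h := leftMul e I f with hh
  set i : ℍᵐᵒᵖ := op (Complex.I : ℍ) with hi
  set j : ℍᵐᵒᵖ := op quatJ with hj
  have hk : ∀ k, ∫ t in (0 : ℝ)..1, sLeftResolvent e T (sliceEmb I (γ k t))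
        (leftMul e (-(sliceEmb I (deriv (γ k) t) * I)) f)
      = (-(1 / 2) : ℝ) • (i • ((∫ t in (0 : ℝ)..1, F k f t) + j • ∫ t in (0 : ℝ)..1, F k (j • f) t)
        + ((∫ t in (0 : ℝ)..1, F k h t) - j • ∫ t in (0 : ℝ)..1, F k (j • h) t)) := by
    intro k
    have hf : IntervalIntegrable (fun t => j • F k (j • f) t) MeasureTheory.volume 0 1 :=
      (hint k (j • f)).smul j
    have hh : IntervalIntegrable (fun t => j • F k (j • h) t) MeasureTheory.volume 0 1 :=
      (hint k (j • h)).smul j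
    have hfi : IntervalIntegrable (fun t => i • (F k f t + j • F k (j • f) t))
      MeasureTheory.volume 0 1 := ((hint k f).add hf).smul i
    rw [← integral_right_smul j (hint k (j • f)), ← integral_right_smul j (hint k (j • h)),
      ← intervalIntegral.integral_add (hint k f) hf,
      ← intervalIntegral.integral_sub (hint k h) hh,
      ← integral_right_smul i ((hint k f).add hf),
      ← intervalIntegral.integral_add hfi ((hint k h).sub hh),
      ← intervalIntegral.integral_smul]
    refine intervalIntegral.integral_congr fun t ht => ?_
    rw [uIcc_of_le zero_le_one] at ht
    exact sLeftResolvent_eq he T hI (hT k t ht) f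
  rw [rieszIntegral, Finset.sum_congr rfl fun k _ => hk k, ← Finset.smul_sum,
    Finset.sum_add_distrib, ← Finset.smul_sum, Finset.sum_add_distrib, Finset.sum_sub_distrib,
    ← Finset.smul_sum, ← Finset.smul_sum, hsum, hsum, hsum, hsum]
  have hcomm : ∀ (q : ℍᵐᵒᵖ) (r : ℝ) (v : V), q • r • v = r • q • v := fun q r v =>
    (smul_comm r q v).symm
  have hii : ∀ v : V, i • i • v = -v := fun v => by
    rw [smul_smul, hi, opI_mul_opI, neg_smul, one_smul]
  have hjij : ∀ v : V, j • i • j • v = i • v := fun v => by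
    rw [smul_smul, smul_smul, hi, hj, opJ_mul_opI_mul_opJ]
  rw [P.map_smul, P.map_smul, hcomm, hjij, hcomm, hjij, sub_self, add_zero, ← two_smul ℝ,
    hcomm, hcomm, hii, smul_smul, smul_smul, smul_smul, smul_neg, ← neg_smul]
  have hpi := Real.pi_ne_zero
  convert one_smul ℝ (P f) using 2
  field_simp

end Integrand

/-! ### Existence of an admissible domain. -/

theorem coe_I_mem_imagUnits : (Complex.I : ℍ) ∈ imagUnits := by
  refine ⟨?_, ?_⟩
  · simp
  · rw [norm_coeComplex, Complex.norm_I]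

theorem dist_sliceEmb {I : ℍ} (hI : I ∈ imagUnits) (z w : ℂ) :
    dist (sliceEmb I z) (sliceEmb I w) = ‖z - w‖ := by
  rw [dist_eq_norm, ← norm_sliceEmb hI (z - w)]
  congr 1
  simp only [sliceEmb, Complex.sub_re, Complex.sub_im, Quaternion.coe_sub, mul_sub]
  abel

section Existence

variable {V : Type*} [NormedAddCommGroup V] [NormedSpace ℝ V] [Module ℍᵐᵒᵖ V]
  [IsScalarTower ℝ ℍᵐᵒᵖ V] [NormSMulClass ℍᵐᵒᵖ V] [CompleteSpace V] {T P : V →L[ℍᵐᵒᵖ] V}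

theorem isIsolatedPart_rangePart (hP : IsIdempotentElem P) (hTP : T * P = P * T)
    (hdisj : Disjoint (sSpectrum (rangePart T P hTP)) (sSpectrum (kerPart T P hTP))) :
    IsIsolatedPart T (sSpectrum (rangePart T P hTP)) := by
  have := completeSpace_range hP
  have := completeSpace_ker P
  refine ⟨?_, isAxiallySymmetric_sSpectrum _, isClosed_sSpectrum _, ?_⟩
  · rw [sSpectrum_eq_union hP hTP]
    exact subset_union_left
  · rw [sSpectrum_eq_union hP hTP, union_sdiff_left, hdisj.sdiff_eq_right]
    exact isClosed_sSpectrum _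

/-- Both spectra depend only on real part and norm, so it suffices to separate them in the slice of
`i`. There `σ_S(T₁)` has a symmetric neighbourhood `D` bounded by Jordan curves whose closure misses
`σ_S(T₂)`; `U` is `D` rotated about the real axis. -/
theorem exists_isRieszDomain (hP : IsIdempotentElem P) (hTP : T * P = P * T)
    (hdist : Metric.AreSeparated (sSpectrum (rangePart T P hTP)) (sSpectrum (kerPart T P hTP))) :
    ∃ U, IsRieszDomain T (sSpectrum (rangePart T P hTP)) U := by
  have := completeSpace_range hP
  have := completeSpace_ker P
  obtain ⟨r, hr, hle⟩ := hdist
  -- The separation constant `r` may be infinite; a finite `ε` below it is needed as mesh scale.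
  obtain ⟨ε, hε, hεr⟩ := ENNReal.lt_iff_exists_nnreal_btwn.1 (pos_iff_ne_zero.2 hr)
  have hε' : (0 : ℝ) < ε := by exact_mod_cast hε
  have hunion := sSpectrum_eq_union hP hTP
  have h1 : ∀ {q p : ℍ}, q.re = p.re → ‖q‖ = ‖p‖ → q ∈ sSpectrum (rangePart T P hTP) →
      p ∈ sSpectrum (rangePart T P hTP) := fun hre hn hq hp =>
    hq ((mem_sResolventSet_congr _ hre hn).2 hp)
  have h2 : ∀ {q p : ℍ}, q.re = p.re → ‖q‖ = ‖p‖ → q ∈ sSpectrum (kerPart T P hTP) →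
      p ∈ sSpectrum (kerPart T P hTP) := fun hre hn hq hp =>
    hq ((mem_sResolventSet_congr _ hre hn).2 hp)
  have hi := coe_I_mem_imagUnits
  set K : Set ℂ := slice (Complex.I : ℍ) (sSpectrum (rangePart T P hTP)) with hK
  have hslice : ∀ {I : ℍ}, I ∈ imagUnits → ∀ {z : ℂ},
      sliceEmb I z ∈ sSpectrum (rangePart T P hTP) → z ∈ K := fun hI z hz =>
    h1 (by rw [re_sliceEmb hI, re_sliceEmb hi]) (by rw [norm_sliceEmb hI, norm_sliceEmb hi]) hz
  have hKc : IsCompact K := by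
    refine Metric.isCompact_of_isClosed_isBounded
      ((isClosed_sSpectrum _).preimage (continuous_sliceEmb _)) ?_
    obtain ⟨R, hR⟩ := (isBounded_sSpectrum (rangePart T P hTP)).exists_norm_le
    refine isBounded_iff_forall_norm_le.2 ⟨R, fun z hz => ?_⟩
    rw [← norm_sliceEmb hi]
    exact hR _ hz
  have hKconj : ∀ z ∈ K, starRingEnd ℂ z ∈ K := fun z hz =>
    h1 (by rw [re_sliceEmb hi, re_sliceEmb hi, Complex.conj_re])
      (by rw [norm_sliceEmb hi, norm_sliceEmb hi, RCLike.norm_conj]) hz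
  obtain ⟨D, hDo, hDb, hKD, hDconj, hDε, n, γ, hγ⟩ := exists_symmetric_neighbourhood hKc hKconj hε'
  have hfar : ∀ z ∈ closure D, sliceEmb (Complex.I : ℍ) z ∉ sSpectrum (kerPart T P hTP) := by
    intro z hz hz2
    obtain ⟨w, hw, hzw⟩ := hDε z hz
    have h := hεr.trans_le (hle _ hw _ hz2)
    rw [edist_comm, edist_dist, dist_sliceEmb hi, ← ENNReal.ofReal_coe_nnreal,
      ENNReal.ofReal_lt_ofReal_iff_of_nonneg ε.coe_nonneg] at h
    exact absurd hzw (not_le.2 h)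
  have hupper : ∀ q : ℍ, q.re = (sliceEmb (Complex.I : ℍ) (upperPt q)).re ∧
      ‖q‖ = ‖sliceEmb (Complex.I : ℍ) (upperPt q)‖ := fun q =>
    ⟨by rw [re_sliceEmb hi]; rfl, by rw [norm_sliceEmb hi, norm_upperPt]⟩
  refine ⟨upperPt ⁻¹' D, hDo.preimage continuous_upperPt, ?_,
    isAxiallySymmetric_preimage_upperPt D, ?_, fun I hI => ?_, fun I hI => ⟨n, γ, ?_⟩⟩
  · obtain ⟨R, hR⟩ := hDb.exists_norm_le
    refine isBounded_iff_forall_norm_le.2 ⟨R, fun q hq => ?_⟩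
    rw [← norm_upperPt]
    exact hR _ hq
  · rw [hunion]
    ext q
    refine ⟨fun ⟨hqD, hq⟩ => hq.resolve_right fun hq2 => ?_, fun hq => ⟨hKD ?_, Or.inl hq⟩⟩
    · exact hfar _ (subset_closure hqD) (h2 (hupper q).1 (hupper q).2 hq2)
    · exact h1 (hupper q).1 (hupper q).2 hq
  · rw [slice_preimage_upperPt hI hDconj]
    rintro _ ⟨z, hz, rfl⟩
    by_contra hzT
    have hzT' : sliceEmb I z ∈ sSpectrum T := hzT
    rw [hunion] at hzT'
    rcases hzT' with hz1 | hz2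
    · exact (hDo.frontier_eq ▸ hz).2 (hKD (hslice hI hz1))
    · exact hfar z (frontier_subset_closure hz) (h2 (by rw [re_sliceEmb hI, re_sliceEmb hi])
        (by rw [norm_sliceEmb hI, norm_sliceEmb hi]) hz2)
  · rwa [slice_preimage_upperPt hI hDconj]

end Existence

/-- The projection `P` is the Riesz projection of `T` for the `S`-spectrum of the part of `T` in
the range of `P`, and the only one. -/
theorem isRieszProjection_iff {V : Type*} [NormedAddCommGroup V] [NormedSpace ℝ V]
    [Module ℍᵐᵒᵖ V] [IsScalarTower ℝ ℍᵐᵒᵖ V] [RightInner V] [CompleteSpace V]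
    {ι : Type*} {e : ι → V} (he : IsHilbertBasis e)
    {T P : V →L[ℍᵐᵒᵖ] V} (hP : IsIdempotentElem P) (hTP : T * P = P * T)
    (hdist : Metric.AreSeparated (sSpectrum (rangePart T P hTP)) (sSpectrum (kerPart T P hTP)))
    {E : V →L[ℍᵐᵒᵖ] V} :
    IsRieszProjection e T (sSpectrum (rangePart T P hTP)) E ↔ E = P := by
  constructor
  · rintro ⟨-, U, hU, I, hI, n, γ, hγ, hE⟩
    ext f
    rw [hE, rieszIntegral_eq he hP hTP hdist.disjoint hU hI hγ]
  · rintro rfl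
    obtain ⟨U, hU⟩ := exists_isRieszDomain hP hTP hdist
    obtain ⟨n, γ, hγ⟩ := hU.exists_curves _ coe_I_mem_imagUnits
    exact ⟨isIsolatedPart_rangePart hP hTP hdist.disjoint, U, hU, _, coe_I_mem_imagUnits, n, γ, hγ,
      fun f => (rieszIntegral_eq he hP hTP hdist.disjoint hU coe_I_mem_imagUnits hγ f).symm⟩

end QuaternionicRiesz

end

/-- Independence of `U`, `I` and the parametrization appears as uniqueness of `E`; it holds because
every admissible choice gives `P`. -/
theorem theoremp {V : Type*} [NormedAddCommGroup V] [NormedSpace ℝ V] [Module ℍᵐᵒᵖ V]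
    [IsScalarTower ℝ ℍᵐᵒᵖ V] [QuaternionicRiesz.RightInner V] [CompleteSpace V]
    {ι : Type*} (e : ι → V) (he : QuaternionicRiesz.IsHilbertBasis e)
    (T P : V →L[ℍᵐᵒᵖ] V) (hP : IsIdempotentElem P) (hTP : T * P = P * T)
    (hdist : Metric.AreSeparated
      (QuaternionicRiesz.sSpectrum (QuaternionicRiesz.rangePart T P hTP))
      (QuaternionicRiesz.sSpectrum (QuaternionicRiesz.kerPart T P hTP))) :
    (∃! E : V →L[ℍᵐᵒᵖ] V, QuaternionicRiesz.IsRieszProjection e T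
      (QuaternionicRiesz.sSpectrum (QuaternionicRiesz.rangePart T P hTP)) E) ∧
    ∀ E : V →L[ℍᵐᵒᵖ] V,
      QuaternionicRiesz.IsRieszProjection e T
        (QuaternionicRiesz.sSpectrum (QuaternionicRiesz.rangePart T P hTP)) E →
      LinearMap.range (P : V →ₗ[ℍᵐᵒᵖ] V) = LinearMap.range (E : V →ₗ[ℍᵐᵒᵖ] V) ∧
      LinearMap.ker (P : V →ₗ[ℍᵐᵒᵖ] V) = LinearMap.ker (E : V →ₗ[ℍᵐᵒᵖ] V) := by
  have h := fun E => QuaternionicRiesz.isRieszProjection_iff he hP hTP hdist (E := E)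
  exact ⟨⟨P, (h P).2 rfl, fun E hE => (h E).1 hE⟩, fun E hE => by
    rw [(h E).1 hE]
    exact ⟨rfl, rfl⟩⟩
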